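/- Let $X$ be a locally compact Hadamard space, i.e. a locally compact, complete geodesic metric space whose geodesic triangles are at least as thin as their comparison triangles in the Euclidean plane (CAT(0)). Its ideal boundary $\partial_\infty X$ is the set of classes of unit speed geodesic rays $[0,\infty)\to X$, two rays being asymptotic if their distance stays bounded. The Tits boundary $\partial_{Tits}X$ is $\partial_\infty X$ with the Tits angle metric $\angle_{Tits}(\xi,\eta)=\sup_{x\in X}\angle_x(\xi,\eta)$, where $\angle_x(\xi,\eta)$ is the angle at $x$ between the rays from $x$ asymptotic to $\xi$ and $\eta$. Let $s\subseteq\partial_{Tits}X$ be a unit sphere, i.e. a subset which with the metric $\angle_{Tits}$ is isometric to the unit sphere $S^d\subset\mathbb R^{d+1}$ with its angular metric, for some integer $d\ge 0$. Suppose that $s$ does not bound a unit hemisphere in $\partial_{Tits}X$, i.e. there is no subset $h\subseteq\partial_{Tits}X$ isometric to a closed hemisphere of a Euclidean unit sphere (with its angular metric) such that the isometry carries the boundary sphere of the hemisphere onto $s$. Then there exists a flat $F\subseteq X$, i.e. a convex subset isometric to some Euclidean space $\mathbb R^n$, with $\partial_\infty F=s$, where $\partial_\infty F$ is the set of ideal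 points represented by geodesic rays contained in $F$. -/

import Mathlib

open Filter Topology
open scoped NNReal

noncomputable section

namespace TitsGeometry

variable {X : Type*} [MetricSpace X]

/-- `γ` restricts to a unit speed geodesic segment, defined on `[0, dist p q]`, from `p` to `q`. -/
def IsGeodesicSegment (γ : ℝ → X) (p q : X) : Prop :=
  γ 0 = p ∧ γ (dist p q) = q ∧
    ∀ a ∈ Set.Icc 0 (dist p q), ∀ b ∈ Set.Icc 0 (dist p q), dist (γ a) (γ b) = |a - b|

/-- A Hadamard space: a complete geodesic metric space all of whose geodesic triangles are at least
as thin as their comparison triangles in the Euclidean plane (`x'`, `y'` are the comparison points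
of the points `γ a`, `δ b` on the two sides issuing from `p`). -/
structure IsHadamardSpace (X : Type*) [MetricSpace X] : Prop where
  complete : CompleteSpace X
  exists_geodesic : ∀ p q : X, ∃ γ : ℝ → X, IsGeodesicSegment γ p q
  comparison : ∀ (p q r : X) (γ δ : ℝ → X),
    IsGeodesicSegment γ p q → IsGeodesicSegment δ p r →
    ∀ a ∈ Set.Icc 0 (dist p q), ∀ b ∈ Set.Icc 0 (dist p r),
    ∀ p' q' r' x' y' : EuclideanSpace ℝ (Fin 2),
      dist p' q' = dist p q → dist p' r' = dist p r → dist q' r' = dist q r →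
      dist p' x' = a → dist x' q' = dist p q - a →
      dist p' y' = b → dist y' r' = dist p r - b →
      dist (γ a) (δ b) ≤ dist x' y'

/-- Unit speed geodesic rays `[0, ∞) → X`. -/
def Ray (X : Type*) [MetricSpace X] : Type _ := {ρ : ℝ≥0 → X // Isometry ρ}

/-- Two rays are asymptotic if their distance stays bounded. -/
def Asymptotic (ρ σ : Ray X) : Prop := ∃ C : ℝ, ∀ t : ℝ≥0, dist (ρ.1 t) (σ.1 t) ≤ C

/-- Being asymptotic is an equivalence relation. -/
def asymptoticSetoid (X : Type*) [MetricSpace X] : Setoid (Ray X) where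
  r := Asymptotic
  iseqv :=
    { refl := fun _ => ⟨0, fun _ => (dist_self _).le⟩
      symm := fun ⟨C, h⟩ => ⟨C, fun t => by rw [dist_comm]; exact h t⟩
      trans := fun ⟨C, h⟩ ⟨D, k⟩ =>
        ⟨C + D, fun t => (dist_triangle _ _ _).trans (add_le_add (h t) (k t))⟩ }

/-- The ideal boundary: asymptote classes of rays. -/
def IdealBoundary (X : Type*) [MetricSpace X] : Type _ := Quotient (asymptoticSetoid X)

/-- The ideal point `ρ(∞)` represented by a ray. -/
def Ray.endpoint (ρ : Ray X) : IdealBoundary X := Quotient.mk (asymptoticSetoid X) ρ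

/-- The angle at the vertex corresponding to `p` in a Euclidean comparison triangle
for `p, q, r` (meaningful for `q ≠ p ≠ r`), by the law of cosines. -/
def comparisonAngle (p q r : X) : ℝ :=
  Real.arccos ((dist p q ^ 2 + dist p r ^ 2 - dist q r ^ 2) / (2 * dist p q * dist p r))

/-- The angle between two rays with the same initial point. -/
def rayAngle (ρ σ : Ray X) : ℝ :=
  limsup (fun z : ℝ≥0 × ℝ≥0 => comparisonAngle (ρ.1 0) (ρ.1 z.1) (σ.1 z.2))
    (𝓝[>] (0 : ℝ≥0) ×ˢ 𝓝[>] (0 : ℝ≥0))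

/-- The Tits angle: the supremum over all points `x` of `X` of the visual angle at `x`, that is of
the angle at `x` between rays from `x` to the two ideal points. -/
def titsAngle (ξ η : IdealBoundary X) : ℝ :=
  sSup {a : ℝ | ∃ ρ σ : Ray X,
    ρ.1 0 = σ.1 0 ∧ ρ.endpoint = ξ ∧ σ.endpoint = η ∧ a = rayAngle ρ σ}

/-- `f` restricts to an isometric embedding of `A`, a subset of a Euclidean unit sphere with its
angular metric, into the Tits boundary. -/
def IsTitsIsometricOn {n : ℕ} (f : EuclideanSpace ℝ (Fin n) → IdealBoundary X)
    (A : Set (EuclideanSpace ℝ (Fin n))) : Prop :=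
  ∀ u ∈ A, ∀ v ∈ A, titsAngle (f u) (f v) = InnerProductGeometry.angle u v

/-- `s` is isometric, in the Tits angle metric, to the unit sphere of some dimension `d ≥ 0`. -/
def IsUnitSphere (s : Set (IdealBoundary X)) : Prop :=
  ∃ (d : ℕ) (f : EuclideanSpace ℝ (Fin (d + 1)) → IdealBoundary X),
    IsTitsIsometricOn f (Metric.sphere 0 1) ∧ f '' Metric.sphere 0 1 = s

/-- `s` is the boundary of a unit hemisphere in the Tits boundary, i.e. of an isometric copy of the
closed hemisphere `{u ∈ Sᵐ | 0 ≤ u₀}`, whose boundary sphere is `{u ∈ Sᵐ | u₀ = 0}`. -/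
def BoundsUnitHemisphere (s : Set (IdealBoundary X)) : Prop :=
  ∃ (m : ℕ) (f : EuclideanSpace ℝ (Fin (m + 1)) → IdealBoundary X),
    IsTitsIsometricOn f {u | u ∈ Metric.sphere 0 1 ∧ 0 ≤ u 0} ∧
      f '' {u | u ∈ Metric.sphere 0 1 ∧ u 0 = 0} = s

/-- A subset is (geodesically) convex if it contains every geodesic segment joining two of
its points. -/
def IsGeodesicallyConvex (C : Set X) : Prop :=
  ∀ p ∈ C, ∀ q ∈ C, ∀ γ : ℝ → X, IsGeodesicSegment γ p q →
    ∀ a ∈ Set.Icc 0 (dist p q), γ a ∈ C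

/-- A flat: a convex subset isometric to a Euclidean space. -/
def IsFlat (F : Set X) : Prop :=
  IsGeodesicallyConvex F ∧
    ∃ (n : ℕ) (i : EuclideanSpace ℝ (Fin n) → X), Isometry i ∧ Set.range i = F

/-- The ideal boundary of a subset: the endpoints of the rays contained in it. -/
def idealBoundaryOf (F : Set X) : Set (IdealBoundary X) :=
  {ξ | ∃ ρ : Ray X, (∀ t, ρ.1 t ∈ F) ∧ ρ.endpoint = ξ}

end TitsGeometry

end

/-!
Write `b_u` for the Busemann function of the point `f u` of the given sphere `f`, normalised at a
base point `o`. The basic fact is the law of cosines at infinity: the Tits angle of two ideal points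
is the limit of the comparison angles along rays with a common origin, which increase to it
(`IsHadamardSpace.titsAngle_eq_arccos_and`). Hence moving a point by `t` towards `f u` adds to
`b_w` at most `-t ⟪u, w⟫`, and never increases a sum `b_w + b_{-w}`; and for every apex `x` the
cone map, which sends a vector to the point at that distance and direction from `x`, does not
increase distances.

Fix an orthonormal basis `e` and let `K` be the set where all `b_{± e i}` are nonpositive.

If `K` is bounded, a weighted sum of the functions `b_w + b_{-w}`, over a dense sequence of `w` in
the sphere, attains its minimum over `K` at some `x`. Any point reached from `x` by moving towards
the sphere can be brought back into `K` by moves towards the points `± e i`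
(`IsHadamardSpace.exists_busemannAt_nonpos`), so by minimality none of the sums changes along the
rays from `x`. This forces each `b_w` to be affine on the cone with apex `x`. As Busemann functions
are 1-Lipschitz, the cone map also does not decrease distances: its image is the desired flat
(`IsHadamardSpace.isFlat_range_coneMap`).

If `K` is unbounded, it contains a ray `q` from `o` by properness, and by convexity all `b_u` are
nonpositive along `q` (`IsHadamardSpace.busemannAt_nonpos_of_basis`): the endpoint of `q` is
orthogonal to the sphere. The cones with apices on `q`, rescaled, converge to a Euclidean
half-space, whose boundary at infinity is a hemisphere bounded by the sphere. Its points are limits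
of geodesics from `o`; the distance estimates that make the limit isometric to a hemisphere come
from upper bounds for Busemann functions together with the sublinear lower bound for
`b_u + b_{-u}` (`IsHadamardSpace.exists_le_busemannAt_add`), which holds because antipodes have Tits
angle `π`. This contradicts the hypothesis that the sphere bounds no hemisphere.
-/

namespace TitsGeometry

/-! ### The CAT(0) inequality -/

/-- Three numbers subject to the triangle inequalities are the side lengths of a triangle in the
Euclidean plane. -/
lemma exists_comparison_triangle {a b c : ℝ} (ha : 0 ≤ a) (hb : 0 ≤ b) (hc : 0 ≤ c)
    (hab : c ≤ a + b) (hbc : a ≤ b + c) (hac : b ≤ a + c) :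
    ∃ p q r : EuclideanSpace ℝ (Fin 2), dist p q = a ∧ dist p r = b ∧ dist q r = c := by
  rcases ha.eq_or_lt with rfl | ha
  · obtain rfl : b = c := by linarith
    refine ⟨!₂[0, 0], !₂[0, 0], !₂[b, 0], ?_, ?_, ?_⟩ <;>
      simp [EuclideanSpace.dist_eq, Real.dist_eq, Real.sqrt_sq hb]
  · set x : ℝ := (a ^ 2 + b ^ 2 - c ^ 2) / (2 * a) with hx
    have hxa : 2 * a * x = a ^ 2 + b ^ 2 - c ^ 2 := by rw [hx]; field_simp
    have hxb : x ^ 2 ≤ b ^ 2 := by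
      apply sq_le_sq'
      · have : 0 ≤ 2 * a * (x + b) := by nlinarith
        by_contra h
        push Not at h
        nlinarith
      · have : 0 ≤ 2 * a * (b - x) := by nlinarith
        by_contra h
        push Not at h
        nlinarith
    have hy : Real.sqrt (b ^ 2 - x ^ 2) ^ 2 = b ^ 2 - x ^ 2 := Real.sq_sqrt (by linarith)
    refine ⟨!₂[0, 0], !₂[a, 0], !₂[x, Real.sqrt (b ^ 2 - x ^ 2)], ?_, ?_, ?_⟩
    · simp [EuclideanSpace.dist_eq, Real.dist_eq, Real.sqrt_sq ha.le]
    · simp only [EuclideanSpace.dist_eq, Real.dist_eq, Fin.sum_univ_two, sq_abs]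
      rw [Real.sqrt_eq_iff_mul_self_eq (by positivity) hb]
      simp
      nlinarith
    · simp only [EuclideanSpace.dist_eq, Real.dist_eq, Fin.sum_univ_two, sq_abs]
      rw [Real.sqrt_eq_iff_mul_self_eq (by positivity) hc]
      simp
      nlinarith

/-- `r` restricts to a unit speed geodesic on `[0, L]`. -/
def IsGeod {X : Type*} [MetricSpace X] (r : ℝ → X) (L : ℝ) : Prop :=
  ∀ a ∈ Set.Icc 0 L, ∀ b ∈ Set.Icc 0 L, dist (r a) (r b) = |a - b|

variable {X : Type*} [MetricSpace X]

lemma IsGeodesicSegment.isGeod {γ : ℝ → X} {p q : X} (h : IsGeodesicSegment γ p q) :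
    IsGeod γ (dist p q) := h.2.2

lemma IsGeod.dist_zero {r : ℝ → X} {L a : ℝ} (h : IsGeod r L) (ha : a ∈ Set.Icc 0 L) :
    dist (r 0) (r a) = a := by
  rw [h 0 ⟨le_rfl, ha.1.trans ha.2⟩ a ha, zero_sub, abs_neg, abs_of_nonneg ha.1]

lemma IsGeod.isGeodesicSegment {r : ℝ → X} {L : ℝ} (h : IsGeod r L) (hL : 0 ≤ L) :
    IsGeodesicSegment r (r 0) (r L) := by
  have h0 := h.dist_zero ⟨hL, le_rfl⟩
  refine ⟨rfl, by rw [h0], by rw [h0]; exact h⟩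

/-- Stewart's theorem turned into an inequality: the form in which the CAT(0) condition is used. -/
lemma IsHadamardSpace.stewart (hX : IsHadamardSpace X) {r : ℝ → X} {L a : ℝ} (h : IsGeod r L)
    (ha : a ∈ Set.Icc 0 L) (y : X) :
    L * dist y (r a) ^ 2 ≤
      (L - a) * dist y (r 0) ^ 2 + a * dist y (r L) ^ 2 - a * (L - a) * L := by
  have hL : 0 ≤ L := ha.1.trans ha.2
  rcases hL.eq_or_lt with rfl | hL0
  · obtain rfl : a = 0 := le_antisymm ha.2 ha.1
    simp
  have hseg := h.isGeodesicSegment hL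
  have hd := h.dist_zero (a := L) ⟨hL, le_rfl⟩
  obtain ⟨δ, hδ⟩ := hX.exists_geodesic (r 0) y
  obtain ⟨p', q', r', h1, h2, h3⟩ := exists_comparison_triangle (a := dist (r 0) (r L))
    (b := dist (r 0) y) (c := dist (r L) y) dist_nonneg dist_nonneg dist_nonneg
    (by rw [dist_comm (r 0)]; exact dist_triangle _ _ _)
    (by rw [dist_comm (r L) y]; exact dist_triangle _ _ _) (dist_triangle _ _ _)
  set x' : EuclideanSpace ℝ (Fin 2) := p' + (a / L) • (q' - p') with hx'
  have hpq : ‖q' - p'‖ = L := by rw [← dist_eq_norm, dist_comm, h1, hd]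
  have e1 : dist p' x' = a := by
    rw [dist_eq_norm, hx', sub_add_cancel_left, norm_neg, norm_smul, hpq, Real.norm_eq_abs,
      abs_of_nonneg (div_nonneg ha.1 hL)]
    field_simp
  have e2 : dist x' q' = L - a := by
    have : x' - q' = -((1 - a / L) • (q' - p')) := by rw [hx']; module
    rw [dist_eq_norm, this, norm_neg, norm_smul, hpq, Real.norm_eq_abs, abs_of_nonneg]
    · field_simp
    · rw [sub_nonneg, div_le_one hL0]; exact ha.2
  have key := hX.comparison (r 0) (r L) y r δ hseg hδ a (by rwa [hd]) (dist (r 0) y)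
    ⟨dist_nonneg, le_rfl⟩ p' q' r' x' r' h1 h2 h3 e1 (by rw [e2, hd]) h2 (by simp)
  rw [hδ.2.1] at key
  have key2 : dist (r a) y ^ 2 ≤ dist x' r' ^ 2 := by gcongr
  have euc : L * dist x' r' ^ 2 =
      (L - a) * dist p' r' ^ 2 + a * dist q' r' ^ 2 - a * (L - a) * L := by
    have hu : x' - r' = (1 - a / L) • (p' - r') + (a / L) • (q' - r') := by rw [hx']; module
    have hv : q' - p' = (q' - r') - (p' - r') := by abel
    have n1 := norm_add_sq_real ((1 - a / L) • (p' - r')) ((a / L) • (q' - r'))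
    have n2 := norm_sub_sq_real (q' - r') (p' - r')
    rw [← hv, hpq, real_inner_comm] at n2
    rw [← hu, inner_smul_left, inner_smul_right, norm_smul, norm_smul, mul_pow, mul_pow,
      Real.norm_eq_abs, Real.norm_eq_abs, sq_abs, sq_abs] at n1
    simp only [conj_trivial] at n1
    have n3 : inner ℝ (p' - r') (q' - r') =
      (‖q' - r'‖ ^ 2 + ‖p' - r'‖ ^ 2 - L ^ 2) / 2 := by linarith
    rw [dist_eq_norm, dist_eq_norm, dist_eq_norm, n1, n3]
    field_simp
    ring
  rw [h2, h3, dist_comm _ y, dist_comm _ y] at euc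
  rw [dist_comm (r a) y] at key2
  calc L * dist y (r a) ^ 2 ≤ L * dist x' r' ^ 2 := by gcongr
    _ = _ := euc

/-- Distance functions are convex along geodesics. -/
lemma IsHadamardSpace.dist_convex (hX : IsHadamardSpace X) {r : ℝ → X} {L a : ℝ} (h : IsGeod r L)
    (ha : a ∈ Set.Icc 0 L) (y : X) :
    L * dist y (r a) ≤ (L - a) * dist y (r 0) + a * dist y (r L) := by
  have hL : 0 ≤ L := ha.1.trans ha.2
  have hs := hX.stewart h ha y
  have hd := h.dist_zero (a := L) ⟨hL, le_rfl⟩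
  have h1 : |dist y (r 0) - dist y (r L)| ≤ L := by
    have := abs_dist_sub_le (r 0) (r L) y
    rwa [hd, dist_comm _ y, dist_comm _ y] at this
  have h2 : (dist y (r 0) - dist y (r L)) ^ 2 ≤ L ^ 2 := by
    rw [← sq_abs]; gcongr
  have hA := dist_nonneg (x := y) (y := r 0)
  have hB := dist_nonneg (x := y) (y := r L)
  have h3 : 0 ≤ a * (L - a) := mul_nonneg ha.1 (sub_nonneg.2 ha.2)
  apply le_of_sq_le_sq _ (by nlinarith [mul_nonneg (sub_nonneg.2 ha.2) hA, mul_nonneg ha.1 hB])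
  nlinarith [mul_le_mul_of_nonneg_left hs hL, mul_le_mul_of_nonneg_left h2 h3]

/-- Geodesics are determined by their endpoints. -/
lemma IsHadamardSpace.geod_unique (hX : IsHadamardSpace X) {r q : ℝ → X} {L a : ℝ}
    (h : IsGeod r L) (k : IsGeod q L) (h0 : r 0 = q 0) (hL : r L = q L) (ha : a ∈ Set.Icc 0 L) :
    r a = q a := by
  have hLn : 0 ≤ L := ha.1.trans ha.2
  rcases hLn.eq_or_lt with rfl | hL0
  · obtain rfl : a = 0 := le_antisymm ha.2 ha.1
    exact h0
  have hs := hX.stewart h ha (q a)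
  have e1 : dist (q a) (r 0) = a := by rw [h0, dist_comm]; exact k.dist_zero ha
  have e2 : dist (q a) (r L) = L - a := by
    rw [hL, k a ha L ⟨hLn, le_rfl⟩, abs_sub_comm, abs_of_nonneg (sub_nonneg.2 ha.2)]
  rw [e1, e2] at hs
  have : L * dist (q a) (r a) ^ 2 ≤ 0 := by nlinarith
  have h2 : dist (q a) (r a) ^ 2 ≤ 0 := by
    by_contra hne
    push Not at hne
    nlinarith [mul_pos hL0 hne]
  have h3 : dist (q a) (r a) = 0 := by
    have := sq_nonneg (dist (q a) (r a))
    exact pow_eq_zero_iff (two_ne_zero) |>.1 (le_antisymm h2 this)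
  exact (dist_eq_zero.1 h3).symm

/-- Comparison angles at the common initial point of two geodesics are monotone
(a statement about their cosines, with denominators cleared). -/
lemma IsHadamardSpace.comparison_mono (hX : IsHadamardSpace X) {r q : ℝ → X} {L M a b : ℝ}
    (h : IsGeod r L) (k : IsGeod q M) (h0 : r 0 = q 0) (ha : a ∈ Set.Icc 0 L)
    (hb : b ∈ Set.Icc 0 M) :
    a * b * (L ^ 2 + M ^ 2 - dist (r L) (q M) ^ 2) ≤
      L * M * (a ^ 2 + b ^ 2 - dist (r a) (q b) ^ 2) := by
  have hL : 0 ≤ L := ha.1.trans ha.2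
  have hM : 0 ≤ M := hb.1.trans hb.2
  have s1 := hX.stewart h ha (q M)
  have s2 := hX.stewart k hb (r a)
  rw [h0, dist_comm (q M) (q 0), k.dist_zero ⟨hM, le_rfl⟩, dist_comm (q M), dist_comm (q M)] at s1
  rw [← h0, dist_comm (r a) (r 0), h.dist_zero ha] at s2
  nlinarith [mul_le_mul_of_nonneg_left s1 hb.1, mul_le_mul_of_nonneg_left s2 hL]

/-- Hopf–Rinow: a locally compact Hadamard space is proper. -/
theorem IsHadamardSpace.properSpace [LocallyCompactSpace X] (hX : IsHadamardSpace X) :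
    ProperSpace X := by
  have := hX.complete
  refine ⟨fun o => ?_⟩
  by_contra! hne
  obtain ⟨r₁, hr₁⟩ := hne
  -- the radii of compact balls have a supremum, which is attained and can then be exceeded
  set S : Set ℝ := {r | IsCompact (Metric.closedBall o r)} with hS
  have hdown : ∀ r ∈ S, ∀ r' ≤ r, r' ∈ S := fun r hr r' hr' =>
    IsCompact.of_isClosed_subset hr Metric.isClosed_closedBall
      (Metric.closedBall_subset_closedBall hr')
  have hbd : BddAbove S := ⟨r₁, fun r hr => by
    by_contra hlt
    exact hr₁ (hdown r hr r₁ (not_le.1 hlt).le)⟩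
  have h0 : (0 : ℝ) ∈ S := by simp [hS]
  set R := sSup S with hR
  have hR0 : 0 ≤ R := le_csSup hbd h0
  have hlt : ∀ r < R, r ∈ S := fun r hr => by
    obtain ⟨r', hr', hlt⟩ := exists_lt_of_lt_csSup ⟨0, h0⟩ hr
    exact hdown r' hr' r hlt.le
  have hRS : R ∈ S := by
    rw [hS, Set.mem_ofPred_eq, isCompact_iff_totallyBounded_isComplete]
    refine ⟨?_, Metric.isClosed_closedBall.isComplete⟩
    rw [Metric.totallyBounded_iff]
    intro ε hε
    set r := max (R - ε / 2) 0 with hr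
    have hrS : r ∈ S := by
      rcases hR0.eq_or_lt with h | h
      · rwa [hr, max_eq_right (by linarith)]
      · exact hlt _ (max_lt (by linarith) h)
    obtain ⟨t, htf, ht⟩ := Metric.totallyBounded_iff.1 (IsCompact.totallyBounded hrS) (ε / 2)
      (half_pos hε)
    refine ⟨t, htf, fun y hy => ?_⟩
    obtain ⟨γ, hγ⟩ := hX.exists_geodesic o y
    have hy' : dist o y ≤ R := by rw [dist_comm]; exact hy
    set a := min r (dist o y) with ha
    have ha0 : a ∈ Set.Icc 0 (dist o y) :=
      ⟨le_min (le_max_right _ _) dist_nonneg, min_le_right _ _⟩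
    have hγa : γ a ∈ Metric.closedBall o r := by
      rw [Metric.mem_closedBall, dist_comm]
      have := hγ.isGeod.dist_zero ha0
      rw [hγ.1] at this
      rw [this]; exact min_le_left _ _
    obtain ⟨z, hz, hzb⟩ := Set.mem_iUnion₂.1 (ht hγa)
    refine Set.mem_iUnion₂.2 ⟨z, hz, ?_⟩
    have h1 : dist (γ (dist o y)) (γ a) = |dist o y - a| :=
      hγ.2.2 _ ⟨dist_nonneg, le_rfl⟩ a ha0
    rw [hγ.2.1, abs_of_nonneg (sub_nonneg.2 ha0.2)] at h1
    have h2 : dist o y - a ≤ ε / 2 := by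
      rcases min_choice r (dist o y) with h | h
      · rw [ha, h]; linarith [le_max_left (R - ε / 2) 0]
      · rw [ha, h]; linarith
    have h3 : dist (γ a) z < ε / 2 := hzb
    rw [Metric.mem_ball]
    linarith [dist_triangle y (γ a) z]
  obtain ⟨δ, hδ, hcomp⟩ := IsCompact.exists_isCompact_cthickening hRS
  have hmem : R + δ / 2 ∈ S := by
    refine IsCompact.of_isClosed_subset hcomp Metric.isClosed_closedBall fun y hy => ?_
    obtain ⟨γ, hγ⟩ := hX.exists_geodesic o y
    have hy' : dist o y ≤ R + δ / 2 := by rw [dist_comm]; exact hy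
    set a := min R (dist o y) with ha
    have ha0 : a ∈ Set.Icc 0 (dist o y) := ⟨le_min hR0 dist_nonneg, min_le_right _ _⟩
    have hγa : γ a ∈ Metric.closedBall o R := by
      rw [Metric.mem_closedBall, dist_comm]
      have := hγ.isGeod.dist_zero ha0
      rw [hγ.1] at this
      rw [this]; exact min_le_left _ _
    refine Metric.mem_cthickening_of_dist_le y (γ a) δ _ hγa ?_
    have h1 : dist (γ (dist o y)) (γ a) = |dist o y - a| :=
      hγ.2.2 _ ⟨dist_nonneg, le_rfl⟩ a ha0
    rw [hγ.2.1, abs_of_nonneg (sub_nonneg.2 ha0.2)] at h1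
    rw [h1]
    rcases min_choice R (dist o y) with h | h
    · rw [ha, h]; linarith
    · rw [ha, h]; linarith
  linarith [le_csSup hbd hmem]

/-! ### Rays and Busemann functions -/

/-- `r` restricts to a unit speed geodesic ray on `[0, ∞)`. Rays are handled as functions on all of
`ℝ`, of which only the values at nonnegative arguments matter. -/
def IsRay (r : ℝ → X) : Prop :=
  ∀ a, 0 ≤ a → ∀ b, 0 ≤ b → dist (r a) (r b) = |a - b|

/-- Two rays stay at bounded distance. -/
def AsymptoticRays (r q : ℝ → X) : Prop := ∃ C : ℝ, ∀ t, 0 ≤ t → dist (r t) (q t) ≤ C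

lemma AsymptoticRays.symm {r q : ℝ → X} (h : AsymptoticRays r q) : AsymptoticRays q r :=
  let ⟨C, hC⟩ := h
  ⟨C, fun t ht => by rw [dist_comm]; exact hC t ht⟩

lemma AsymptoticRays.trans {r q u : ℝ → X} (h : AsymptoticRays r q) (k : AsymptoticRays q u) :
    AsymptoticRays r u :=
  let ⟨C, hC⟩ := h
  let ⟨D, hD⟩ := k
  ⟨C + D, fun t ht => (dist_triangle _ _ _).trans (add_le_add (hC t ht) (hD t ht))⟩

lemma IsRay.isGeod {r : ℝ → X} (h : IsRay r) (L : ℝ) : IsGeod r L :=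
  fun a ha b hb => h a ha.1 b hb.1

lemma IsRay.dist_zero {r : ℝ → X} (h : IsRay r) {t : ℝ} (ht : 0 ≤ t) : dist (r 0) (r t) = t :=
  (h.isGeod t).dist_zero ⟨ht, le_rfl⟩

lemma IsRay.shift {r : ℝ → X} (h : IsRay r) {a : ℝ} (ha : 0 ≤ a) : IsRay fun t => r (a + t) :=
  fun s hs t ht => by rw [h _ (add_nonneg ha hs) _ (add_nonneg ha ht)]; congr 1; ring

/-- The Busemann function of a ray, normalised to vanish at its initial point: the limit of
`dist y (r t) - t`, written as an infimum. -/
noncomputable def busemann (r : ℝ → X) (y : X) : ℝ := ⨅ t : ℝ, (dist y (r (max t 0)) - max t 0)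

lemma IsRay.antitone_dist_sub {r : ℝ → X} (h : IsRay r) (y : X) :
    Antitone fun t : ℝ => dist y (r (max t 0)) - max t 0 := by
  intro a b hab
  have hm : max a 0 ≤ max b 0 := max_le_max_right 0 hab
  have h1 := h (max a 0) (le_max_right _ _) (max b 0) (le_max_right _ _)
  rw [abs_sub_comm, abs_of_nonneg (sub_nonneg.2 hm)] at h1
  have := dist_triangle y (r (max a 0)) (r (max b 0))
  simp only
  linarith

lemma IsRay.bddBelow_dist_sub {r : ℝ → X} (h : IsRay r) (y : X) :
    BddBelow (Set.range fun t : ℝ => dist y (r (max t 0)) - max t 0) := by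
  refine ⟨-dist y (r 0), ?_⟩
  rintro _ ⟨t, rfl⟩
  have h1 := h.dist_zero (le_max_right t 0)
  have := dist_triangle (r 0) y (r (max t 0))
  rw [dist_comm (r 0) y] at this
  simp only
  linarith

lemma IsRay.tendsto_busemann {r : ℝ → X} (h : IsRay r) (y : X) :
    Tendsto (fun t => dist y (r t) - t) atTop (𝓝 (busemann r y)) := by
  refine (tendsto_atTop_ciInf (h.antitone_dist_sub y) (h.bddBelow_dist_sub y)).congr' ?_
  filter_upwards [eventually_ge_atTop (0 : ℝ)] with t ht
  rw [max_eq_left ht]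

lemma IsRay.busemann_le {r : ℝ → X} (h : IsRay r) (y : X) {t : ℝ} (ht : 0 ≤ t) :
    busemann r y ≤ dist y (r t) - t := by
  have := ciInf_le (h.bddBelow_dist_sub y) t
  simp only [max_eq_left ht] at this
  exact this

/-- An upper bound of the shape of `IsHadamardSpace.dist_sq_le` bounds the Busemann function. -/
lemma IsRay.busemann_le_of_dist_sq_le {r : ℝ → X} (h : IsRay r) {y : X} {A β : ℝ}
    (hA : ∀ s, 0 ≤ s → dist y (r s) ^ 2 ≤ A + s ^ 2 + 2 * s * β) : busemann r y ≤ β := by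
  have hlim : Tendsto (fun s : ℝ => A / 2 * s⁻¹ + β) atTop (𝓝 (A / 2 * 0 + β)) :=
    (tendsto_inv_atTop_zero.const_mul _).add_const _
  rw [mul_zero, zero_add] at hlim
  refine ge_of_tendsto hlim ?_
  filter_upwards [eventually_gt_atTop (0 : ℝ)] with s hs
  refine (h.busemann_le y hs.le).trans ?_
  refine le_of_mul_le_mul_left (a := 2 * s) ?_ (by positivity)
  have : 2 * s * (A / 2 * s⁻¹ + β) = A + 2 * s * β := by field_simp
  rw [this]
  nlinarith [sq_nonneg (dist y (r s) - s), hA s hs.le]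

lemma IsRay.busemann_sub_le {r : ℝ → X} (h : IsRay r) (y z : X) :
    busemann r y - busemann r z ≤ dist y z := by
  refine le_of_tendsto ((h.tendsto_busemann y).sub (h.tendsto_busemann z)) (Eventually.of_forall ?_)
  intro t
  have := dist_triangle y z (r t)
  linarith

lemma IsRay.abs_busemann_sub_le {r : ℝ → X} (h : IsRay r) (y z : X) :
    |busemann r y - busemann r z| ≤ dist y z :=
  abs_sub_le_iff.2 ⟨h.busemann_sub_le y z, by rw [dist_comm]; exact h.busemann_sub_le z y⟩

lemma IsRay.continuous_busemann {r : ℝ → X} (h : IsRay r) : Continuous (busemann r) := by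
  have : LipschitzWith 1 (busemann r) := LipschitzWith.of_dist_le_mul fun y z => by
    rw [Real.dist_eq, NNReal.coe_one, one_mul]; exact h.abs_busemann_sub_le y z
  exact this.continuous

lemma IsRay.busemann_apply {r : ℝ → X} (h : IsRay r) {t : ℝ} (ht : 0 ≤ t) :
    busemann r (r t) = -t := by
  refine tendsto_nhds_unique (h.tendsto_busemann (r t)) (tendsto_const_nhds.congr' ?_)
  filter_upwards [eventually_ge_atTop t] with s hs
  rw [h t ht s (ht.trans hs), abs_sub_comm, abs_of_nonneg (sub_nonneg.2 hs)]
  ring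

lemma IsRay.busemann_zero {r : ℝ → X} (h : IsRay r) : busemann r (r 0) = 0 := by
  rw [h.busemann_apply le_rfl, neg_zero]

lemma IsRay.abs_busemann_le {r : ℝ → X} (h : IsRay r) (y : X) :
    |busemann r y| ≤ dist (r 0) y := by
  have := h.abs_busemann_sub_le y (r 0)
  rwa [h.busemann_zero, sub_zero, dist_comm] at this

lemma IsHadamardSpace.busemann_convex (hX : IsHadamardSpace X) {r γ : ℝ → X} (h : IsRay r)
    {L a : ℝ} (hγ : IsGeod γ L) (ha : a ∈ Set.Icc 0 L) :
    L * busemann r (γ a) ≤ (L - a) * busemann r (γ 0) + a * busemann r (γ L) := by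
  refine le_of_tendsto_of_tendsto' ((h.tendsto_busemann (γ a)).const_mul L)
    (((h.tendsto_busemann (γ 0)).const_mul (L - a)).add
      ((h.tendsto_busemann (γ L)).const_mul a)) fun t => ?_
  have := hX.dist_convex hγ ha (r t)
  rw [dist_comm _ (γ a), dist_comm _ (γ 0), dist_comm _ (γ L)] at this
  linarith

/-- The limit of Stewart's inequality for geodesics from `p` whose lengths tend to infinity. -/
lemma IsHadamardSpace.stewart_limit (hX : IsHadamardSpace X) {ι : Type*} {F : Filter ι} [NeBot F]
    {γ : ι → ℝ → X} {L : ι → ℝ} {p y z : X} {β s : ℝ} (hγ : ∀ i, IsGeod (γ i) (L i))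
    (h0 : ∀ i, γ i 0 = p) (hL : Tendsto L F atTop)
    (hβ : Tendsto (fun i => dist y (γ i (L i)) - L i) F (𝓝 β)) (hs : 0 ≤ s)
    (hz : Tendsto (fun i => γ i s) F (𝓝 z)) :
    dist y z ^ 2 ≤ dist y p ^ 2 + s ^ 2 + 2 * s * β := by
  have hinv : Tendsto (fun i => (L i)⁻¹) F (𝓝 0) := tendsto_inv_atTop_zero.comp hL
  have lim : Tendsto (fun i => (1 - s * (L i)⁻¹) * dist y p ^ 2 + s ^ 2 +
      s * ((dist y (γ i (L i)) - L i) * (2 + (dist y (γ i (L i)) - L i) * (L i)⁻¹))) F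
      (𝓝 ((1 - s * 0) * dist y p ^ 2 + s ^ 2 + s * (β * (2 + β * 0)))) := by
    refine Tendsto.add (Tendsto.add_const _ ?_) ?_
    · exact (tendsto_const_nhds.sub (hinv.const_mul s)).mul_const _
    · exact (hβ.mul (tendsto_const_nhds.add (hβ.mul hinv))).const_mul s
  have := le_of_tendsto_of_tendsto ((tendsto_const_nhds (x := y)).dist hz |>.pow 2) lim ?_
  · linarith
  filter_upwards [hL.eventually_ge_atTop s, hL.eventually_gt_atTop 0] with i h1 h2
  have hst := hX.stewart (hγ i) ⟨hs, h1⟩ y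
  rw [h0 i] at hst
  refine le_of_mul_le_mul_left (hst.trans (le_of_eq ?_)) h2
  field_simp
  ring

/-- The basic upper bound for the distance to a point on a ray. -/
lemma IsHadamardSpace.dist_sq_le (hX : IsHadamardSpace X) {r : ℝ → X} (h : IsRay r) (y : X)
    {s : ℝ} (hs : 0 ≤ s) :
    dist y (r s) ^ 2 ≤ dist y (r 0) ^ 2 + s ^ 2 + 2 * s * busemann r y :=
  hX.stewart_limit (F := atTop) (γ := fun _ : ℝ => r) (L := fun t => t) (fun t => h.isGeod t)
    (fun _ => rfl) tendsto_id (h.tendsto_busemann y) hs tendsto_const_nhds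

/-- In a proper space, geodesics from `p` of lengths tending to infinity converge to a ray along
an ultrafilter. -/
lemma exists_limit_ray [ProperSpace X] {ι : Type*} (F : Ultrafilter ι) {γ : ι → ℝ → X}
    {L : ι → ℝ} {p : X} (hγ : ∀ i, IsGeod (γ i) (L i)) (h0 : ∀ i, γ i 0 = p)
    (hL : Tendsto L F atTop) :
    ∃ r : ℝ → X, IsRay r ∧ r 0 = p ∧ ∀ t, 0 ≤ t → Tendsto (fun i => γ i t) F (𝓝 (r t)) := by
  have key : ∀ t : ℝ, ∃ z : X, 0 ≤ t → Tendsto (fun i => γ i t) F (𝓝 z) := by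
    intro t
    by_cases ht : 0 ≤ t
    · have hev : ∀ᶠ i in (F : Filter ι), γ i t ∈ Metric.closedBall p t := by
        filter_upwards [hL.eventually_ge_atTop t] with i hi
        rw [Metric.mem_closedBall, dist_comm, ← h0 i, (hγ i).dist_zero ⟨ht, hi⟩]
      obtain ⟨z, -, hz⟩ := (isCompact_closedBall p t).ultrafilter_le_nhds
        (F.map fun i => γ i t) (by rw [le_principal_iff]; exact hev)
      exact ⟨z, fun _ => hz⟩
    · exact ⟨p, fun h => absurd h ht⟩
  choose r hr using key
  refine ⟨r, fun a ha b hb => ?_, ?_, hr⟩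
  · refine tendsto_nhds_unique ((hr a ha).dist (hr b hb)) (tendsto_const_nhds.congr' ?_)
    filter_upwards [hL.eventually_ge_atTop a, hL.eventually_ge_atTop b] with i h1 h2
    exact (hγ i a ⟨ha, h1⟩ b ⟨hb, h2⟩).symm
  · refine tendsto_nhds_unique (hr 0 le_rfl) (tendsto_const_nhds.congr fun i => (h0 i).symm)

lemma IsHadamardSpace.exists_geod (hX : IsHadamardSpace X) (p q : X) :
    ∃ γ : ℝ → X, IsGeod γ (dist p q) ∧ γ 0 = p ∧ γ (dist p q) = q := by
  obtain ⟨γ, hγ⟩ := hX.exists_geodesic p q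
  exact ⟨γ, hγ.isGeod, hγ.1, hγ.2.1⟩

lemma IsGeod.reverse {r : ℝ → X} {L : ℝ} (h : IsGeod r L) : IsGeod (fun t => r (L - t)) L := by
  intro a ha b hb
  rw [h (L - a) ⟨by linarith [ha.2], by linarith [ha.1]⟩ (L - b) ⟨by linarith [hb.2],
    by linarith [hb.1]⟩, ← abs_neg]
  congr 1
  ring

/-- Every point is the origin of a ray asymptotic to a given ray `σ`, and the bound of `dist_sq_le`
for the new ray holds with the Busemann function of `σ`. -/
lemma IsHadamardSpace.exists_asymptotic_ray [ProperSpace X] (hX : IsHadamardSpace X) {σ : ℝ → X}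
    (h : IsRay σ) (p : X) :
    ∃ r : ℝ → X, IsRay r ∧ r 0 = p ∧ AsymptoticRays r σ ∧ ∀ y s, 0 ≤ s →
      dist y (r s) ^ 2 ≤ dist y p ^ 2 + s ^ 2 + 2 * s * (busemann σ y - busemann σ p) := by
  choose γ hγ h0 h1 using fun n : ℕ => hX.exists_geod p (σ n)
  set D := dist p (σ 0) with hD
  have hLD : ∀ n : ℕ, |dist p (σ n) - n| ≤ D := fun n => by
    have e1 := h.dist_zero (Nat.cast_nonneg n)
    have := abs_dist_sub_le p (σ 0) (σ n)
    rwa [e1] at this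
  have hLat : Tendsto (fun n : ℕ => dist p (σ n)) atTop atTop := by
    refine tendsto_atTop_mono (fun n => ?_)
      (tendsto_atTop_add_const_right _ (-D) (tendsto_natCast_atTop_atTop (R := ℝ)))
    linarith [(abs_le.1 (hLD n)).1]
  have hF : ((hyperfilter ℕ : Ultrafilter ℕ) : Filter ℕ) ≤ atTop := Nat.hyperfilter_le_atTop
  obtain ⟨r, hr, hr0, hlim⟩ := exists_limit_ray (hyperfilter ℕ) hγ h0 (hLat.mono_left hF)
  refine ⟨r, hr, hr0, ⟨2 * D, fun t ht => ?_⟩, fun y s hs => ?_⟩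
  · refine le_of_tendsto ((hlim t ht).dist tendsto_const_nhds) (hF ?_)
    filter_upwards [hLat.eventually_ge_atTop t, hLat.eventually_gt_atTop 0,
      eventually_gt_atTop 0] with n hn1 hn2 hn3
    set L := dist p (σ n) with hL
    have hn : (0 : ℝ) < n := Nat.cast_pos.2 hn3
    have hb : (n : ℝ) * ((L - t) / L) ∈ Set.Icc 0 (n : ℝ) := by
      constructor
      · exact mul_nonneg hn.le (div_nonneg (by linarith) hn2.le)
      · apply mul_le_of_le_one_right hn.le
        rw [div_le_one hn2]; linarith
    -- compare the geodesics from `σ n` to `p` and to `σ 0`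
    have hm := hX.comparison_mono (hγ n).reverse (h.isGeod n).reverse
      (by simp only [sub_zero]; exact h1 n) (a := L - t) (b := n * ((L - t) / L))
      ⟨by linarith, by linarith⟩ hb
    simp only [sub_self] at hm
    rw [h0 n, ← hD, ← hL, sub_sub_cancel] at hm
    have e2 : (n : ℝ) - n * ((L - t) / L) = n * t / L := by field_simp; ring
    rw [e2] at hm
    have e3 : dist (γ n t) (σ (n * t / L)) ≤ D := by
      refine le_of_sq_le_sq ?_ dist_nonneg
      have e4 : L * n * dist (γ n t) (σ (n * t / L)) ^ 2 ≤ L * n * ((L - t) / L) ^ 2 * D ^ 2 := by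
        have e5 : (L - t) * (n * ((L - t) / L)) = L * n * ((L - t) / L) ^ 2 := by field_simp
        have e6 : L * n * ((L - t) ^ 2 + (n * ((L - t) / L)) ^ 2) =
            L * n * ((L - t) / L) ^ 2 * (L ^ 2 + n ^ 2) := by field_simp
        rw [e5] at hm
        linarith
      have e7 : ((L - t) / L) ^ 2 ≤ 1 := by
        apply pow_le_one₀ (div_nonneg (by linarith) hn2.le)
        rw [div_le_one hn2]; linarith
      have e8 : L * n * dist (γ n t) (σ (n * t / L)) ^ 2 ≤ L * n * D ^ 2 := by
        refine e4.trans ?_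
        have : 0 ≤ L * n * D ^ 2 := by positivity
        nlinarith
      exact le_of_mul_le_mul_left e8 (by positivity)
    have e9 : dist (σ (n * t / L)) (σ t) ≤ D := by
      rw [h _ (by positivity) t ht]
      have : n * t / L - t = (t / L) * -(L - n) := by field_simp; ring
      rw [this, abs_mul, abs_neg, abs_of_nonneg (div_nonneg ht hn2.le)]
      refine (mul_le_of_le_one_left (abs_nonneg _) ?_).trans (hLD n)
      rwa [div_le_one hn2]
    linarith [dist_triangle (γ n t) (σ (n * t / L)) (σ t)]
  · refine hX.stewart_limit hγ h0 (hLat.mono_left hF) ?_ hs (hlim s hs)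
    have hc : Tendsto (fun n : ℕ => (n : ℝ)) (hyperfilter ℕ : Ultrafilter ℕ) atTop :=
      tendsto_natCast_atTop_atTop.mono_left hF
    refine (((h.tendsto_busemann y).comp hc).sub ((h.tendsto_busemann p).comp hc)).congr fun n => ?_
    simp only [Function.comp, h1]
    ring

/-- Asymptotic rays with the same origin coincide. -/
lemma IsHadamardSpace.ray_unique (hX : IsHadamardSpace X) {r q : ℝ → X} (h : IsRay r)
    (k : IsRay q) (hrq : AsymptoticRays r q) (h0 : r 0 = q 0) {t : ℝ} (ht : 0 ≤ t) :
    r t = q t := by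
  obtain ⟨C, hC⟩ := hrq
  rw [← dist_le_zero]
  by_contra! hpos
  set d := dist (r t) (q t) with hd
  have hC0 : 0 ≤ C := dist_nonneg.trans (hC t ht)
  set T := t * C / d + t + 1 with hT
  have hTt : t ≤ T := by rw [hT]; linarith [div_nonneg (mul_nonneg ht hC0) hpos.le]
  have hT0 : 0 < T := by rw [hT]; linarith [div_nonneg (mul_nonneg ht hC0) hpos.le]
  have hm := hX.comparison_mono (h.isGeod T) (k.isGeod T) h0 ⟨ht, hTt⟩ ⟨ht, hTt⟩
  have h1 : (T * d) ^ 2 ≤ (t * C) ^ 2 := by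
    have : dist (r T) (q T) ^ 2 ≤ C ^ 2 := by gcongr; exact hC T hT0.le
    nlinarith [mul_le_mul_of_nonneg_left this (mul_nonneg ht ht)]
  have h2 := le_of_sq_le_sq h1 (by positivity)
  have h3 : T * d = t * C + (t + 1) * d := by rw [hT]; field_simp; ring
  nlinarith [mul_pos (by linarith : 0 < t + 1) hpos]

/-- Busemann functions of asymptotic rays differ by a constant. -/
lemma IsHadamardSpace.busemann_eq [ProperSpace X] (hX : IsHadamardSpace X) {r σ : ℝ → X}
    (h : IsRay r) (k : IsRay σ) (hrs : AsymptoticRays r σ) (y : X) :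
    busemann r y = busemann σ y - busemann σ (r 0) := by
  apply le_antisymm
  · obtain ⟨r', hr', h0', has, hK⟩ := hX.exists_asymptotic_ray k (r 0)
    refine h.busemann_le_of_dist_sq_le (A := dist y (r 0) ^ 2) fun s hs => ?_
    rw [← hX.ray_unique hr' h (has.trans hrs.symm) h0' hs]
    exact hK y s hs
  · obtain ⟨C, hC⟩ := hrs
    -- `busemann σ (r a) + a` is convex and bounded above, hence nonincreasing
    have hdec : ∀ a, 0 ≤ a → busemann σ (r a) ≤ busemann σ (r 0) - a := by
      intro a ha
      have hlim : Tendsto (fun L : ℝ => (1 - a * L⁻¹) * busemann σ (r 0) + a * C * L⁻¹ - a) atTop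
          (𝓝 ((1 - a * 0) * busemann σ (r 0) + a * C * 0 - a)) := by
        refine Tendsto.sub_const
          (Tendsto.add (Tendsto.mul_const _ (tendsto_const_nhds.sub ?_)) ?_) _
        · exact tendsto_inv_atTop_zero.const_mul _
        · exact tendsto_inv_atTop_zero.const_mul _
      rw [mul_zero, sub_zero, one_mul, mul_zero, add_zero] at hlim
      refine ge_of_tendsto hlim ?_
      filter_upwards [eventually_gt_atTop (0 : ℝ), eventually_ge_atTop a] with L hL haL
      have h1 := hX.busemann_convex k (h.isGeod L) ⟨ha, haL⟩
      have h2 := k.busemann_sub_le (r L) (σ L)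
      rw [k.busemann_apply hL.le] at h2
      have h3 : busemann σ (r L) ≤ C - L := by linarith [hC L hL.le]
      refine le_of_mul_le_mul_left (h1.trans ?_) hL
      have : L * ((1 - a * L⁻¹) * busemann σ (r 0) + a * C * L⁻¹ - a) =
        (L - a) * busemann σ (r 0) + a * (C - L) := by field_simp; ring
      rw [this]
      gcongr
    refine ge_of_tendsto (h.tendsto_busemann y) ?_
    filter_upwards [eventually_ge_atTop (0 : ℝ)] with t ht
    linarith [hdec t ht, k.busemann_sub_le y (r t)]

/-! ### The Tits angle as an asymptotic comparison angle -/

/-- `r` is a ray issuing from `p` and representing the ideal point `ξ`. -/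
structure IsRayTo (r : ℝ → X) (p : X) (ξ : IdealBoundary X) : Prop where
  isRay : IsRay r
  zero : r 0 = p
  exists_endpoint : ∃ ρ : Ray X, ρ.endpoint = ξ ∧ ∀ t : ℝ≥0, ρ.1 t = r t

/-- The ray in the sense of `Ray` given by a function satisfying `IsRay`. -/
def IsRay.toRay {r : ℝ → X} (h : IsRay r) : Ray X :=
  ⟨fun t => r t, Isometry.of_dist_eq fun a b => by
    rw [h a a.2 b b.2, NNReal.dist_eq]⟩

lemma IsRay.isRayTo {r : ℝ → X} (h : IsRay r) : IsRayTo r (r 0) h.toRay.endpoint :=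
  ⟨h, rfl, h.toRay, rfl, fun _ => rfl⟩

lemma Ray.isRayTo (ρ : Ray X) : IsRayTo (fun t => ρ.1 t.toNNReal) (ρ.1 0) ρ.endpoint := by
  refine ⟨fun a ha b hb => ?_, by simp, ρ, rfl, fun t => by simp⟩
  rw [ρ.2.dist_eq, NNReal.dist_eq, Real.coe_toNNReal a ha, Real.coe_toNNReal b hb]

lemma IsRayTo.asymptotic {r q : ℝ → X} {p p' : X} {ξ : IdealBoundary X} (h : IsRayTo r p ξ)
    (k : IsRayTo q p' ξ) : AsymptoticRays r q := by
  obtain ⟨ρ, hρ, hr⟩ := h.exists_endpoint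
  obtain ⟨σ, hσ, hq⟩ := k.exists_endpoint
  obtain ⟨C, hC⟩ : Asymptotic ρ σ := Quotient.exact (hρ.trans hσ.symm)
  refine ⟨C, fun t ht => ?_⟩
  rw [show r t = ρ.1 ⟨t, ht⟩ from (hr ⟨t, ht⟩).symm, show q t = σ.1 ⟨t, ht⟩ from (hq ⟨t, ht⟩).symm]
  exact hC _

lemma IsRayTo.of_asymptotic {r q : ℝ → X} {p : X} {ξ : IdealBoundary X} (h : IsRayTo r p ξ)
    (k : IsRay q) (hqr : AsymptoticRays q r) : IsRayTo q (q 0) ξ := by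
  obtain ⟨ρ, hρ, hr⟩ := h.exists_endpoint
  refine ⟨k, rfl, k.toRay, ?_, fun _ => rfl⟩
  rw [← hρ]
  obtain ⟨C, hC⟩ := hqr
  refine Quotient.sound (s := asymptoticSetoid X) ⟨C, fun t => ?_⟩
  rw [hr]
  exact hC t t.2

lemma IsRayTo.shift {r : ℝ → X} {p : X} {ξ : IdealBoundary X} (h : IsRayTo r p ξ) {a : ℝ}
    (ha : 0 ≤ a) : IsRayTo (fun t => r (a + t)) (r a) ξ := by
  have := h.of_asymptotic (h.isRay.shift ha) ⟨a, fun t ht => by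
    rw [h.isRay _ (add_nonneg ha ht) _ ht]; simp [abs_of_nonneg ha]⟩
  simpa only [add_zero] using this

lemma IsHadamardSpace.exists_rayTo [ProperSpace X] (hX : IsHadamardSpace X) (p : X)
    (ξ : IdealBoundary X) : ∃ r : ℝ → X, IsRayTo r p ξ := by
  obtain ⟨ρ, rfl⟩ : ∃ ρ : Ray X, ρ.endpoint = ξ := Quotient.exists_rep ξ
  obtain ⟨r, hr, h0, has, -⟩ := hX.exists_asymptotic_ray ρ.isRayTo.isRay p
  exact ⟨r, h0 ▸ ρ.isRayTo.of_asymptotic hr has⟩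

lemma comparisonAngle_nonneg (p q r : X) : 0 ≤ comparisonAngle p q r := Real.arccos_nonneg _

lemma comparisonAngle_le_pi (p q r : X) : comparisonAngle p q r ≤ Real.pi := Real.arccos_le_pi _

lemma le_rayAngle {ρ σ : Ray X} {θ : ℝ} (h : ∀ t s : ℝ≥0, 0 < t → 0 < s →
    θ ≤ comparisonAngle (ρ.1 0) (ρ.1 t) (σ.1 s)) : θ ≤ rayAngle ρ σ := by
  refine le_limsup_of_frequently_le (Eventually.frequently ?_)
    (isBoundedUnder_of ⟨Real.pi, fun z => comparisonAngle_le_pi _ _ _⟩)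
  filter_upwards [prod_mem_prod self_mem_nhdsWithin self_mem_nhdsWithin] with z hz
  exact h _ _ hz.1 hz.2

lemma rayAngle_le_of_le {ρ σ : Ray X} {θ : ℝ} (h : ∀ t s : ℝ≥0, 0 < t → 0 < s → t ≤ 1 → s ≤ 1 →
    comparisonAngle (ρ.1 0) (ρ.1 t) (σ.1 s) ≤ θ) : rayAngle ρ σ ≤ θ := by
  have hb : IsBoundedUnder (· ≥ ·) (𝓝[>] (0 : ℝ≥0) ×ˢ 𝓝[>] (0 : ℝ≥0))
      (fun z : ℝ≥0 × ℝ≥0 => comparisonAngle (ρ.1 0) (ρ.1 z.1) (σ.1 z.2)) :=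
    isBoundedUnder_of ⟨0, fun z => comparisonAngle_nonneg _ _ _⟩
  refine limsup_le_of_le hb.isCoboundedUnder_le ?_
  have h1 : Set.Ioc (0 : ℝ≥0) 1 ∈ 𝓝[>] (0 : ℝ≥0) := Ioc_mem_nhdsGT zero_lt_one
  filter_upwards [prod_mem_prod h1 h1] with z hz
  exact h _ _ hz.1.1 hz.2.1 hz.1.2 hz.2.2

lemma rayAngle_le_pi (ρ σ : Ray X) : rayAngle ρ σ ≤ Real.pi :=
  rayAngle_le_of_le fun _ _ _ _ _ _ => comparisonAngle_le_pi _ _ _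

lemma bddAbove_rayAngle (ξ η : IdealBoundary X) :
    BddAbove {a : ℝ | ∃ ρ σ : Ray X,
      ρ.1 0 = σ.1 0 ∧ ρ.endpoint = ξ ∧ σ.endpoint = η ∧ a = rayAngle ρ σ} := by
  refine ⟨Real.pi, ?_⟩
  rintro _ ⟨ρ, σ, -, -, -, rfl⟩
  exact rayAngle_le_pi ρ σ

lemma comparisonAngle_ray {ρ σ : Ray X} (h0 : ρ.1 0 = σ.1 0) (t s : ℝ≥0) :
    comparisonAngle (ρ.1 0) (ρ.1 t) (σ.1 s) =
      Real.arccos (((t : ℝ) ^ 2 + (s : ℝ) ^ 2 - dist (ρ.1 t) (σ.1 s) ^ 2) / (2 * t * s)) := by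
  have e1 : dist (ρ.1 0) (ρ.1 t) = t := by rw [ρ.2.dist_eq, NNReal.dist_eq]; simp
  have e2 : dist (ρ.1 0) (σ.1 s) = s := by rw [h0, σ.2.dist_eq, NNReal.dist_eq]; simp
  rw [comparisonAngle, e1, e2]

/-- Comparison angles at any point are bounded by the asymptotic comparison angle at `p`, because
asymptotic rays stay at bounded distance. -/
lemma IsHadamardSpace.titsAngle_le_arccos (hX : IsHadamardSpace X) {r q : ℝ → X}
    {p : X} {ξ η : IdealBoundary X} {κ : ℝ} (hr : IsRayTo r p ξ) (hq : IsRayTo q p η)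
    (hup : ∀ t s, 0 ≤ t → 0 ≤ s → dist (r t) (q s) ^ 2 ≤ t ^ 2 + s ^ 2 - 2 * t * s * κ) :
    titsAngle ξ η ≤ Real.arccos κ := by
  obtain ⟨ρ₀, hρ₀, hr₀⟩ := hr.exists_endpoint
  obtain ⟨σ₀, hσ₀, hq₀⟩ := hq.exists_endpoint
  refine csSup_le ⟨_, ρ₀, σ₀, ?_, hρ₀, hσ₀, rfl⟩ ?_
  · rw [hr₀, hq₀, NNReal.coe_zero, hr.zero, hq.zero]
  rintro _ ⟨ρ, σ, h0, hρ, hσ, rfl⟩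
  refine rayAngle_le_of_le fun t s ht hs _ _ => ?_
  rw [comparisonAngle_ray h0]
  refine Real.arccos_le_arccos ?_
  set r' : ℝ → X := fun t => ρ.1 t.toNNReal with hr'def
  set q' : ℝ → X := fun t => σ.1 t.toNNReal with hq'def
  have hr' : IsRayTo r' (ρ.1 0) ξ := hρ ▸ ρ.isRayTo
  have hq' : IsRayTo q' (σ.1 0) η := hσ ▸ σ.isRayTo
  have et : ρ.1 t = r' t := by simp [hr'def]
  have es : σ.1 s = q' s := by simp [hq'def]
  have ht' : (0 : ℝ) < t := ht
  have hs' : (0 : ℝ) < s := hs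
  rw [et, es, le_div_iff₀ (by positivity)]
  obtain ⟨C, hC⟩ := hr'.asymptotic hr
  obtain ⟨D, hD⟩ := hq'.asymptotic hq
  have hC0 : 0 ≤ C := dist_nonneg.trans (hC 0 le_rfl)
  have hD0 : 0 ≤ D := dist_nonneg.trans (hD 0 le_rfl)
  have hlim : Tendsto (fun T : ℝ => t * s * (2 * κ - 4 * (C + D) * T⁻¹ - (C + D) ^ 2 * (T⁻¹ * T⁻¹)))
      atTop (𝓝 (t * s * (2 * κ - 4 * (C + D) * 0 - (C + D) ^ 2 * (0 * 0)))) := by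
    have hinv := tendsto_inv_atTop_zero (𝕜 := ℝ)
    exact ((tendsto_const_nhds.sub (hinv.const_mul _)).sub
      ((hinv.mul hinv).const_mul _)).const_mul _
  have hle := le_of_tendsto hlim (b := t ^ 2 + s ^ 2 - dist (r' t) (q' s) ^ 2) ?_
  · linarith
  filter_upwards [eventually_ge_atTop (t : ℝ), eventually_ge_atTop (s : ℝ)] with T h1 h2
  have hT : 0 < T := ht'.trans_le h1
  have hm := hX.comparison_mono (hr'.isRay.isGeod T) (hq'.isRay.isGeod T)
    (by rw [hr'.zero, hq'.zero, h0]) ⟨ht'.le, h1⟩ ⟨hs'.le, h2⟩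
  have h3 : dist (r' T) (q' T) ≤ dist (r T) (q T) + (C + D) := by
    have := dist_triangle4 (r' T) (r T) (q T) (q' T)
    have e1 := hC T hT.le
    have e2 := hD T hT.le
    rw [dist_comm] at e2
    linarith
  have h4 : dist (r T) (q T) ≤ 2 * T := by
    have := dist_triangle_left (r T) (q T) p
    have e1 := hr.isRay.dist_zero hT.le
    have e2 := hq.isRay.dist_zero hT.le
    rw [hr.zero] at e1
    rw [hq.zero] at e2
    linarith
  have h5 := hup T T hT.le hT.le
  have h6 : dist (r' T) (q' T) ^ 2 ≤ 2 * T ^ 2 - 2 * T ^ 2 * κ + 4 * T * (C + D) + (C + D) ^ 2 := by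
    have : dist (r' T) (q' T) ^ 2 ≤ (dist (r T) (q T) + (C + D)) ^ 2 := by gcongr
    nlinarith
  refine le_of_mul_le_mul_left (a := T * T) (le_trans (le_of_eq ?_) (le_trans
    (mul_le_mul_of_nonneg_left (sub_le_sub_left h6 (T ^ 2 + T ^ 2)) (by positivity)) hm))
    (by positivity)
  field_simp
  ring

/-- The angle at a far point `r t` is at least the comparison angle at `p` of `r t` and a point
of `q` tending to infinity. -/
lemma IsHadamardSpace.arccos_le_titsAngle [ProperSpace X] (hX : IsHadamardSpace X) {r q : ℝ → X}
    {p : X} {ξ η : IdealBoundary X} {κ t s : ℝ} (hr : IsRayTo r p ξ) (hq : IsRayTo q p η)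
    (ht : 0 < t) (hs : 0 < s)
    (hlow : t ^ 2 + s ^ 2 - 2 * t * s * κ ≤ dist (r t) (q s) ^ 2) :
    Real.arccos κ ≤ titsAngle ξ η := by
  have hB : -t * κ ≤ busemann q (r t) := by
    have := hX.dist_sq_le hq.isRay (r t) hs.le
    have e1 := hr.isRay.dist_zero ht.le
    rw [hq.zero, ← hr.zero, dist_comm _ (r 0), e1] at this
    nlinarith
  set B := busemann q (r t) with hBdef
  have hr' := hr.shift ht.le
  obtain ⟨q', hq'⟩ := hX.exists_rayTo (r t) η
  have h00 : hr'.isRay.toRay.1 0 = hq'.isRay.toRay.1 0 := by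
    change r (t + ((0 : ℝ≥0) : ℝ)) = q' ((0 : ℝ≥0) : ℝ)
    rw [NNReal.coe_zero, add_zero, hq'.zero]
  have hend : ∀ {r : ℝ → X} {p : X} {ξ : IdealBoundary X} (h : IsRayTo r p ξ),
      h.isRay.toRay.endpoint = ξ := fun {r p ξ} h => by
    obtain ⟨ρ, rfl, hρ⟩ := h.exists_endpoint
    congr 1
    exact Subtype.ext (funext fun t => (hρ t).symm)
  refine le_trans ?_ (le_csSup (bddAbove_rayAngle ξ η)
    ⟨hr'.isRay.toRay, hq'.isRay.toRay, h00, hend hr', hend hq', rfl⟩)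
  refine le_rayAngle fun a b ha hb => ?_
  rw [comparisonAngle_ray h00]
  refine Real.arccos_le_arccos ?_
  change ((a : ℝ) ^ 2 + (b : ℝ) ^ 2 - dist (r (t + a)) (q' b) ^ 2) / (2 * a * b) ≤ κ
  have ha' : (0 : ℝ) < a := ha
  have hb' : (0 : ℝ) < b := hb
  rw [div_le_iff₀ (by positivity)]
  -- `q' b` is not far from `p`, so by Stewart's inequality on `r` with `r t` between `p` and
  -- `r (t + a)` it is far from `r (t + a)`
  have k1 := hX.dist_sq_le hq'.isRay p hb'.le
  rw [hX.busemann_eq hq'.isRay hq.isRay (hq'.asymptotic hq) p, hq'.zero, ← hBdef, ← hq.zero,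
    hq.isRay.busemann_zero, hq.zero, ← hr.zero, hr.isRay.dist_zero ht.le] at k1
  have k2 := hX.stewart (hr.isRay.isGeod (t + a)) ⟨ht.le, by linarith⟩ (q' b)
  rw [← hq'.zero, dist_comm (q' b) (q' 0), hq'.isRay.dist_zero hb'.le,
    dist_comm _ (r 0), dist_comm _ (r (t + a))] at k2
  refine le_of_mul_le_mul_left (a := t) ?_ ht
  nlinarith [mul_le_mul_of_nonneg_left k1 ha'.le, mul_le_mul_of_nonneg_left hB
    (mul_nonneg ha'.le hb'.le)]

/-- The cosine of the Tits angle. -/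
noncomputable def titsCos (ξ η : IdealBoundary X) : ℝ := Real.cos (titsAngle ξ η)

/-- The law of cosines at infinity: the Tits angle is the limit of the comparison angles along two
rays, and these increase to it. -/
lemma IsHadamardSpace.titsAngle_eq_arccos_and [ProperSpace X] (hX : IsHadamardSpace X)
    {r q : ℝ → X} {p : X} {ξ η : IdealBoundary X} (hr : IsRayTo r p ξ) (hq : IsRayTo q p η) :
    titsAngle ξ η = Real.arccos (titsCos ξ η) ∧
    (∀ t s, 0 ≤ t → 0 ≤ s →
      dist (r t) (q s) ^ 2 ≤ t ^ 2 + s ^ 2 - 2 * t * s * titsCos ξ η) ∧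
    ∀ ε > 0, ∀ᶠ R in atTop, ∀ t s, R ≤ t → R ≤ s →
      t ^ 2 + s ^ 2 - 2 * t * s * (titsCos ξ η + ε) ≤ dist (r t) (q s) ^ 2 := by
  set S : Set ℝ := {c | ∃ t s, 0 < t ∧ 0 < s ∧
    c = (t ^ 2 + s ^ 2 - dist (r t) (q s) ^ 2) / (2 * t * s)} with hS
  have e1 : ∀ t, 0 ≤ t → dist p (r t) = t := fun t ht => by
    rw [← hr.zero]; exact hr.isRay.dist_zero ht
  have e2 : ∀ t, 0 ≤ t → dist p (q t) = t := fun t ht => by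
    rw [← hq.zero]; exact hq.isRay.dist_zero ht
  have hne : S.Nonempty := ⟨_, 1, 1, one_pos, one_pos, rfl⟩
  have hlb : ∀ c ∈ S, -1 ≤ c := by
    rintro _ ⟨t, s, ht, hs, rfl⟩
    rw [le_div_iff₀ (by positivity)]
    have := dist_triangle_left (r t) (q s) p
    rw [e1 t ht.le, e2 s hs.le] at this
    nlinarith [dist_nonneg (x := r t) (y := q s)]
  have hub : ∀ c ∈ S, c ≤ 1 := by
    rintro _ ⟨t, s, ht, hs, rfl⟩
    rw [div_le_iff₀ (by positivity)]
    have := abs_dist_sub_le (r t) (q s) p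
    rw [dist_comm _ p, dist_comm _ p, e1 t ht.le, e2 s hs.le] at this
    have h2 : (t - s) ^ 2 ≤ dist (r t) (q s) ^ 2 := by rw [← sq_abs]; gcongr
    nlinarith
  have hbd : BddBelow S := ⟨-1, hlb⟩
  set κ := sInf S with hκ
  have hκ1 : -1 ≤ κ := le_csInf hne hlb
  have hκ2 : κ ≤ 1 := by
    obtain ⟨c, hc⟩ := hne
    exact (csInf_le hbd hc).trans (hub c hc)
  have hup : ∀ t s, 0 ≤ t → 0 ≤ s → dist (r t) (q s) ^ 2 ≤ t ^ 2 + s ^ 2 - 2 * t * s * κ := by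
    intro t s ht hs
    rcases ht.eq_or_lt with rfl | ht
    · rw [hr.zero, e2 s hs]; simp
    rcases hs.eq_or_lt with rfl | hs
    · rw [hq.zero, dist_comm, e1 t ht.le]; simp
    have := csInf_le hbd ⟨t, s, ht, hs, rfl⟩
    rw [← hκ, le_div_iff₀ (by positivity)] at this
    linarith
  have hlow : ∀ ε > 0, ∃ t s, 0 < t ∧ 0 < s ∧
      t ^ 2 + s ^ 2 - 2 * t * s * (κ + ε) ≤ dist (r t) (q s) ^ 2 := by
    intro ε hε
    obtain ⟨_, ⟨t, s, ht, hs, rfl⟩, hlt⟩ := exists_lt_of_csInf_lt hne (lt_add_of_pos_right κ hε)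
    refine ⟨t, s, ht, hs, ?_⟩
    rw [div_lt_iff₀ (by positivity)] at hlt
    linarith
  have hangle : titsAngle ξ η = Real.arccos κ := by
    refine le_antisymm (hX.titsAngle_le_arccos hr hq hup) ?_
    have hlim : Tendsto (fun ε => Real.arccos (κ + ε)) (𝓝[>] 0) (𝓝 (Real.arccos (κ + 0))) := by
      have hc : Continuous fun ε => Real.arccos (κ + ε) :=
        Real.continuous_arccos.comp (continuous_const.add continuous_id)
      exact hc.continuousWithinAt
    rw [add_zero] at hlim
    refine le_of_tendsto hlim ?_
    filter_upwards [self_mem_nhdsWithin] with ε hε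
    obtain ⟨t, s, ht, hs, h⟩ := hlow ε hε
    exact hX.arccos_le_titsAngle hr hq ht hs h
  have hcos : titsCos ξ η = κ := by rw [titsCos, hangle, Real.cos_arccos hκ1 hκ2]
  rw [hcos]
  refine ⟨hangle, hup, fun ε hε => ?_⟩
  -- by monotonicity, the bound at a single pair of times holds at all later ones
  obtain ⟨t₀, s₀, ht₀, hs₀, h⟩ := hlow ε hε
  filter_upwards [eventually_ge_atTop t₀, eventually_ge_atTop s₀] with R h1 h2 t s ht hs
  have hm := hX.comparison_mono (hr.isRay.isGeod t) (hq.isRay.isGeod s)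
    (hr.zero.trans hq.zero.symm) ⟨ht₀.le, h1.trans ht⟩ ⟨hs₀.le, h2.trans hs⟩
  have htp : 0 < t := ht₀.trans_le (h1.trans ht)
  have hsp : 0 < s := hs₀.trans_le (h2.trans hs)
  have h3 : t * s * (t₀ ^ 2 + s₀ ^ 2 - dist (r t₀) (q s₀) ^ 2) ≤
      t * s * (2 * t₀ * s₀ * (κ + ε)) :=
    mul_le_mul_of_nonneg_left (by linarith) (by positivity)
  have h4 : t₀ * s₀ * (t ^ 2 + s ^ 2 - dist (r t) (q s) ^ 2) ≤
      t₀ * s₀ * (2 * t * s * (κ + ε)) := by linarith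
  linarith [le_of_mul_le_mul_left h4 (by positivity)]

section

variable [ProperSpace X] {r q : ℝ → X} {p : X} {ξ η : IdealBoundary X}

lemma IsHadamardSpace.dist_sq_le_titsCos (hX : IsHadamardSpace X) (hr : IsRayTo r p ξ)
    (hq : IsRayTo q p η) {t s : ℝ} (ht : 0 ≤ t) (hs : 0 ≤ s) :
    dist (r t) (q s) ^ 2 ≤ t ^ 2 + s ^ 2 - 2 * t * s * titsCos ξ η :=
  (hX.titsAngle_eq_arccos_and hr hq).2.1 t s ht hs

lemma IsHadamardSpace.eventually_le_dist_sq (hX : IsHadamardSpace X) (hr : IsRayTo r p ξ)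
    (hq : IsRayTo q p η) {ε : ℝ} (hε : 0 < ε) :
    ∀ᶠ R in atTop, ∀ t s, R ≤ t → R ≤ s →
      t ^ 2 + s ^ 2 - 2 * t * s * (titsCos ξ η + ε) ≤ dist (r t) (q s) ^ 2 :=
  (hX.titsAngle_eq_arccos_and hr hq).2.2 ε hε

lemma IsHadamardSpace.titsAngle_eq_arccos_titsCos (hX : IsHadamardSpace X)
    (hr : IsRayTo r p ξ) (hq : IsRayTo q p η) :
    titsAngle ξ η = Real.arccos (titsCos ξ η) :=
  (hX.titsAngle_eq_arccos_and hr hq).1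

lemma IsHadamardSpace.le_titsCos (hX : IsHadamardSpace X) (hr : IsRayTo r p ξ)
    (hq : IsRayTo q p η) {κ : ℝ}
    (hup : ∀ t s, 0 ≤ t → 0 ≤ s → dist (r t) (q s) ^ 2 ≤ t ^ 2 + s ^ 2 - 2 * t * s * κ) :
    κ ≤ titsCos ξ η := by
  refine le_of_forall_pos_le_add fun ε hε => ?_
  obtain ⟨R, h1, h2⟩ := ((hX.eventually_le_dist_sq hr hq hε).and (eventually_gt_atTop 0)).exists
  have h3 := (h1 R R le_rfl le_rfl).trans (hup R R h2.le h2.le)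
  refine le_of_mul_le_mul_left (a := 2 * R * R) (by linarith) (by positivity)

lemma IsHadamardSpace.titsCos_comm (hX : IsHadamardSpace X) (hr : IsRayTo r p ξ)
    (hq : IsRayTo q p η) : titsCos ξ η = titsCos η ξ := by
  apply le_antisymm
  · refine hX.le_titsCos hq hr fun t s ht hs => ?_
    rw [dist_comm]
    linarith [hX.dist_sq_le_titsCos hr hq hs ht]
  · refine hX.le_titsCos hr hq fun t s ht hs => ?_
    rw [dist_comm]
    linarith [hX.dist_sq_le_titsCos hq hr hs ht]

lemma IsHadamardSpace.busemann_le_titsCos (hX : IsHadamardSpace X) (hr : IsRayTo r p ξ)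
    (hq : IsRayTo q p η) {t : ℝ} (ht : 0 ≤ t) : busemann q (r t) ≤ -t * titsCos ξ η :=
  hq.isRay.busemann_le_of_dist_sq_le (A := t ^ 2) fun s hs => by
    linarith [hX.dist_sq_le_titsCos hr hq ht hs]

lemma IsHadamardSpace.eventually_le_busemann (hX : IsHadamardSpace X) (hr : IsRayTo r p ξ)
    (hq : IsRayTo q p η) {ε : ℝ} (hε : 0 < ε) :
    ∀ᶠ t in atTop, -t * (titsCos ξ η + ε) ≤ busemann q (r t) := by
  filter_upwards [hX.eventually_le_dist_sq hr hq hε, eventually_gt_atTop 0] with t h1 h2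
  have h3 := h1 t t le_rfl le_rfl
  have h4 := hX.dist_sq_le hq.isRay (r t) h2.le
  rw [hq.zero, ← hr.zero, dist_comm (r t) (r 0), hr.isRay.dist_zero h2.le] at h4
  refine le_of_mul_le_mul_left (a := 2 * t) (by linarith) (by positivity)

/-- How a Busemann function changes when moving from `x` towards an ideal point. -/
lemma IsHadamardSpace.busemann_move_le (hX : IsHadamardSpace X) {x : X} (hr : IsRayTo r x ξ)
    (hq : IsRayTo q p η) {t : ℝ} (ht : 0 ≤ t) :
    busemann q (r t) ≤ busemann q x - t * titsCos ξ η := by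
  obtain ⟨q', hq'⟩ := hX.exists_rayTo x η
  have h1 := hX.busemann_le_titsCos hr hq' ht
  rw [hX.busemann_eq hq'.isRay hq.isRay (hq'.asymptotic hq), hq'.zero] at h1
  linarith

end

/-! ### Cones over spheres in the Tits boundary -/

open Classical in
/-- A chosen ray from `p` to `ξ`. -/
noncomputable def rayTo (p : X) (ξ : IdealBoundary X) : ℝ → X :=
  if h : ∃ r : ℝ → X, IsRayTo r p ξ then h.choose else fun _ => p

lemma IsHadamardSpace.isRayTo_rayTo [ProperSpace X] (hX : IsHadamardSpace X) (p : X)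
    (ξ : IdealBoundary X) : IsRayTo (rayTo p ξ) p ξ := by
  have h := hX.exists_rayTo p ξ
  rw [rayTo, dif_pos h]
  exact h.choose_spec

section

variable {U : Type*}

/-- The Busemann function of `f u`, normalised at `o`. -/
noncomputable def busemannAt (f : U → IdealBoundary X) (o : X) (u : U) (y : X) : ℝ :=
  busemann (rayTo o (f u)) y

lemma IsHadamardSpace.continuous_busemannAt [ProperSpace X] (hX : IsHadamardSpace X)
    (f : U → IdealBoundary X) (o : X) (u : U) : Continuous (busemannAt f o u) :=
  (hX.isRayTo_rayTo o (f u)).isRay.continuous_busemann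

lemma IsHadamardSpace.abs_busemannAt_le [ProperSpace X] (hX : IsHadamardSpace X)
    (f : U → IdealBoundary X) (o : X) (u : U) (y : X) : |busemannAt f o u y| ≤ dist o y := by
  have h := hX.isRayTo_rayTo o (f u)
  have := h.isRay.abs_busemann_le y
  rwa [h.zero] at this

lemma IsHadamardSpace.busemannAt_self [ProperSpace X] (hX : IsHadamardSpace X)
    (f : U → IdealBoundary X) (o : X) (u : U) : busemannAt f o u o = 0 := by
  have h := hX.isRayTo_rayTo o (f u)
  have := h.isRay.busemann_zero
  rwa [h.zero] at this

end

variable {E : Type*} [NormedAddCommGroup E] [InnerProductSpace ℝ E]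

/-- On unit vectors, `f` carries inner products to cosines of Tits angles. -/
def IsTitsSphere (f : E → IdealBoundary X) : Prop :=
  ∀ u v, ‖u‖ = 1 → ‖v‖ = 1 → titsCos (f u) (f v) = inner ℝ u v

/-- The Euclidean cone over the sphere `f`, drawn in `X` with apex `p`: the vector `v` goes to the
point at distance `‖v‖` on the ray from `p` to the ideal point `f (v / ‖v‖)`. -/
noncomputable def coneMap (f : E → IdealBoundary X) (p : X) (v : E) : X :=
  rayTo p (f (‖v‖⁻¹ • v)) ‖v‖

lemma exists_unit_smul [Nontrivial E] (v : E) : ∃ u : E, ‖u‖ = 1 ∧ v = ‖v‖ • u := by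
  by_cases hv : v = 0
  · obtain ⟨u, hu⟩ := exists_norm_eq E zero_le_one
    exact ⟨u, hu, by simp [hv]⟩
  · exact ⟨‖v‖⁻¹ • v, norm_smul_inv_norm (𝕜 := ℝ) hv, by
      rw [smul_inv_smul₀ (norm_ne_zero_iff.2 hv)]⟩

section

variable [ProperSpace X] {f : E → IdealBoundary X}

lemma IsHadamardSpace.coneMap_smul (hX : IsHadamardSpace X) (f : E → IdealBoundary X) (p : X)
    {u : E} (hu : ‖u‖ = 1) {t : ℝ} (ht : 0 ≤ t) : coneMap f p (t • u) = rayTo p (f u) t := by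
  rw [coneMap, norm_smul, hu, mul_one, Real.norm_eq_abs, abs_of_nonneg ht]
  rcases ht.eq_or_lt with rfl | ht
  · rw [(hX.isRayTo_rayTo p _).zero, (hX.isRayTo_rayTo p _).zero]
  · rw [inv_smul_smul₀ ht.ne']

lemma IsHadamardSpace.coneMap_zero (hX : IsHadamardSpace X) (f : E → IdealBoundary X) (p : X) :
    coneMap f p 0 = p := by
  rw [coneMap, norm_zero, (hX.isRayTo_rayTo p _).zero]

lemma IsHadamardSpace.dist_coneMap_zero (hX : IsHadamardSpace X) (f : E → IdealBoundary X) (p : X)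
    (v : E) : dist p (coneMap f p v) = ‖v‖ := by
  have h := hX.isRayTo_rayTo p (f (‖v‖⁻¹ • v))
  have h2 := h.isRay.dist_zero (norm_nonneg v)
  rwa [h.zero] at h2

lemma norm_smul_sub_smul_sq {u v : E} (hu : ‖u‖ = 1) (hv : ‖v‖ = 1) (s t : ℝ) :
    ‖s • u - t • v‖ ^ 2 = s ^ 2 + t ^ 2 - 2 * s * t * inner ℝ u v := by
  rw [norm_sub_sq_real, inner_smul_left, inner_smul_right, norm_smul, norm_smul, hu, hv,
    Real.norm_eq_abs, Real.norm_eq_abs]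
  simp only [conj_trivial, mul_one, sq_abs]
  ring

/-- The cone map does not increase distances. -/
lemma IsHadamardSpace.dist_coneMap_le [Nontrivial E] (hX : IsHadamardSpace X)
    (hf : IsTitsSphere f) (p : X) (v w : E) :
    dist (coneMap f p v) (coneMap f p w) ≤ ‖v - w‖ := by
  obtain ⟨u, hu, hv⟩ := exists_unit_smul v
  obtain ⟨u', hu', hw⟩ := exists_unit_smul w
  refine le_of_sq_le_sq ?_ (norm_nonneg _)
  rw [hv, hw, hX.coneMap_smul f p hu (norm_nonneg v), hX.coneMap_smul f p hu' (norm_nonneg w),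
    norm_smul_sub_smul_sq hu hu', ← hf u u' hu hu']
  exact hX.dist_sq_le_titsCos (hX.isRayTo_rayTo _ _) (hX.isRayTo_rayTo _ _) (norm_nonneg v)
    (norm_nonneg w)

/-- Asymptotically the cone map is an isometric embedding. -/
lemma IsHadamardSpace.eventually_le_dist_coneMap [Nontrivial E] (hX : IsHadamardSpace X)
    (hf : IsTitsSphere f) (p : X) (v w : E) {ε : ℝ} (hε : 0 < ε) :
    ∀ᶠ t : ℝ in atTop,
      t ^ 2 * (‖v - w‖ ^ 2 - ε) ≤ dist (coneMap f p (t • v)) (coneMap f p (t • w)) ^ 2 := by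
  obtain ⟨u, hu, hv⟩ := exists_unit_smul v
  obtain ⟨u', hu', hw⟩ := exists_unit_smul w
  have hnorm : ∀ (z : E) {t : ℝ}, 0 ≤ t → dist p (coneMap f p (t • z)) = t * ‖z‖ := by
    intro z t ht
    rw [hX.dist_coneMap_zero, norm_smul, Real.norm_eq_abs, abs_of_nonneg ht]
  rcases (norm_nonneg v).eq_or_lt with h0 | hv0
  · filter_upwards [eventually_ge_atTop (0 : ℝ)] with t ht
    have : v = 0 := norm_eq_zero.1 h0.symm
    rw [this, smul_zero, hX.coneMap_zero, hnorm w ht, zero_sub, norm_neg]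
    nlinarith [mul_nonneg (sq_nonneg t) hε.le]
  rcases (norm_nonneg w).eq_or_lt with h0 | hw0
  · filter_upwards [eventually_ge_atTop (0 : ℝ)] with t ht
    have : w = 0 := norm_eq_zero.1 h0.symm
    rw [this, smul_zero, hX.coneMap_zero, dist_comm, hnorm v ht, sub_zero]
    nlinarith [mul_nonneg (sq_nonneg t) hε.le]
  obtain ⟨R, h1, h2⟩ := ((hX.eventually_le_dist_sq (hX.isRayTo_rayTo p (f u))
    (hX.isRayTo_rayTo p (f u')) (ε := ε / (2 * ‖v‖ * ‖w‖)) (by positivity)).and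
    (eventually_ge_atTop 0)).exists
  filter_upwards [eventually_ge_atTop (R / ‖v‖), eventually_ge_atTop (R / ‖w‖)] with t hv1 hw1
  rw [div_le_iff₀ hv0] at hv1
  rw [div_le_iff₀ hw0] at hw1
  have h3 := h1 _ _ hv1 hw1
  have e1 : t • v = (t * ‖v‖) • u := by rw [mul_smul, ← hv]
  have e2 : t • w = (t * ‖w‖) • u' := by rw [mul_smul, ← hw]
  have e3 : ‖v - w‖ ^ 2 = ‖v‖ ^ 2 + ‖w‖ ^ 2 - 2 * ‖v‖ * ‖w‖ * inner ℝ u u' := by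
    rw [← norm_smul_sub_smul_sq hu hu', ← hv, ← hw]
  rw [e1, e2, hX.coneMap_smul f p hu (h2.trans hv1), hX.coneMap_smul f p hu' (h2.trans hw1)]
  refine le_trans (le_of_eq ?_) h3
  rw [e3, hf u u' hu hu']
  field_simp
  ring

/-- Busemann functions of points of the sphere decrease at least linearly along the cone. -/
lemma IsHadamardSpace.busemannAt_coneMap_le [Nontrivial E] (hX : IsHadamardSpace X)
    (hf : IsTitsSphere f) (o x : X) (v : E) {w : E} (hw : ‖w‖ = 1) :
    busemannAt f o w (coneMap f x v) ≤ busemannAt f o w x - inner ℝ v w := by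
  obtain ⟨u, hu, hv⟩ := exists_unit_smul v
  have := hX.busemann_move_le (hX.isRayTo_rayTo x (f u)) (hX.isRayTo_rayTo o (f w)) (norm_nonneg v)
  rw [hf u w hu hw, ← hX.coneMap_smul f x hu (norm_nonneg v), ← hv] at this
  have e : inner ℝ v w = ‖v‖ * inner ℝ u w := by
    conv_lhs => rw [hv, inner_smul_left]
    simp
  rw [e]
  exact this

/-- The sum of the Busemann functions of two antipodes is bounded below by a sublinear function of
the distance. This replaces the triangle inequality for Tits angles. -/
lemma IsHadamardSpace.exists_le_busemannAt_add (hX : IsHadamardSpace X) (hf : IsTitsSphere f)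
    (o : X) {u : E} (hu : ‖u‖ = 1) {ε : ℝ} (hε : 0 < ε) :
    ∃ C, ∀ y, -ε * dist o y - C ≤ busemannAt f o u y + busemannAt f o (-u) y := by
  have h₁ := hX.isRayTo_rayTo o (f u)
  have h₂ := hX.isRayTo_rayTo o (f (-u))
  have hcos : titsCos (f u) (f (-u)) = -1 := by
    rw [hf u (-u) hu (by rwa [norm_neg]), inner_neg_right, real_inner_self_eq_norm_sq, hu]
    norm_num
  -- compare `y` with the points of the two rays at time `s = dist o y / (ε / 2)`; the errors are
  -- `δ * s` and `dist o y ^ 2 / s`, both at most `(ε / 2) * dist o y` for this `δ`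
  set δ := min 1 (ε ^ 2 / 4) with hδ
  have hδ0 : 0 < δ := lt_min one_pos (by positivity)
  have hδ1 : δ ≤ 1 := min_le_left _ _
  have hδ2 : δ ≤ ε ^ 2 / 4 := min_le_right _ _
  obtain ⟨R, hR1, hR0⟩ := ((hX.eventually_le_dist_sq h₁ h₂ hδ0).and
    (eventually_gt_atTop 0)).exists
  refine ⟨ε * R, fun y => ?_⟩
  set D := dist o y with hD
  have hD0 : 0 ≤ D := dist_nonneg
  rcases lt_or_ge D (ε / 2 * R) with hlt | hge
  · have e1 := (abs_le.1 (hX.abs_busemannAt_le f o u y)).1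
    have e2 := (abs_le.1 (hX.abs_busemannAt_le f o (-u) y)).1
    have : 0 ≤ ε * D := by positivity
    linarith
  · set s := D / (ε / 2) with hs
    have hRs : R ≤ s := by rw [hs, le_div_iff₀ (by positivity)]; linarith
    have hs0 : 0 < s := hR0.trans_le hRs
    have hDs : D = ε / 2 * s := by rw [hs]; field_simp
    have h3 := hR1 s s hRs hRs
    rw [hcos] at h3
    have h4 : s * (2 - δ) ≤ dist (rayTo o (f u) s) (rayTo o (f (-u)) s) := by
      refine le_of_sq_le_sq (le_trans ?_ h3) dist_nonneg
      nlinarith [mul_nonneg (mul_nonneg hδ0.le (sub_nonneg.2 hδ1)) (sq_nonneg s),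
        mul_nonneg hδ0.le (sq_nonneg s)]
    have h5 := hX.dist_sq_le h₁.isRay y hs0.le
    have h6 := hX.dist_sq_le h₂.isRay y hs0.le
    rw [h₁.zero, dist_comm y o, ← hD] at h5
    rw [h₂.zero, dist_comm y o, ← hD] at h6
    have h7 := dist_triangle_left (rayTo o (f u) s) (rayTo o (f (-u)) s) y
    have h8 : s * (2 * s * (-ε * D)) ≤
        s * (2 * s * (busemannAt f o u y + busemannAt f o (-u) y)) := by
      apply mul_le_mul_of_nonneg_left _ hs0.le
      have k1 := two_mul_le_add_sq (dist y (rayTo o (f u) s)) s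
      have k2 := two_mul_le_add_sq (dist y (rayTo o (f (-u)) s)) s
      have k3 : 2 * s * (s * (2 - δ)) ≤ 2 * s * (dist y (rayTo o (f u) s) +
          dist y (rayTo o (f (-u)) s)) :=
        mul_le_mul_of_nonneg_left (h4.trans h7) (by positivity)
      have k4 : 2 * s * (busemannAt f o u y + busemannAt f o (-u) y) ≥
          -2 * s ^ 2 * δ - 2 * D ^ 2 := by
        simp only [busemannAt]
        nlinarith
      have k5 : s ^ 2 * δ ≤ s ^ 2 * (ε ^ 2 / 4) := by gcongr
      rw [hDs] at k4 ⊢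
      nlinarith
    have h9 := le_of_mul_le_mul_left (le_of_mul_le_mul_left h8 hs0) (by positivity)
    have : 0 ≤ ε * R := by positivity
    linarith

end

/-! ### The case of a bounded sublevel set: constructing the flat -/

section

variable {E : Type*} [NormedAddCommGroup E] [InnerProductSpace ℝ E] [Nontrivial E]
  [ProperSpace X] {f : E → IdealBoundary X}

lemma IsHadamardSpace.busemannAt_add_coneMap_le (hX : IsHadamardSpace X) (hf : IsTitsSphere f)
    (o x : X) (v : E) {w : E} (hw : ‖w‖ = 1) :
    busemannAt f o w (coneMap f x v) + busemannAt f o (-w) (coneMap f x v) ≤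
      busemannAt f o w x + busemannAt f o (-w) x := by
  have h1 := hX.busemannAt_coneMap_le hf o x v hw
  have h2 := hX.busemannAt_coneMap_le hf o x v (w := -w) (by rwa [norm_neg])
  rw [inner_neg_right] at h2
  linarith

/-- If the sums of the Busemann functions of the antipodes `± e i` are nonpositive at `x`, then
moving `x` towards the points `± e i` makes all these functions nonpositive individually, without
increasing the sum for any pair of antipodes of the sphere. -/
lemma IsHadamardSpace.exists_busemannAt_nonpos (hX : IsHadamardSpace X) (hf : IsTitsSphere f)
    {ι : Type*} {e : ι → E} (he : Orthonormal ℝ e) (o x : X)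
    (hx : ∀ i, busemannAt f o (e i) x + busemannAt f o (-e i) x ≤ 0) (I : Finset ι) :
    ∃ x', (∀ w : E, ‖w‖ = 1 → busemannAt f o w x' + busemannAt f o (-w) x' ≤
        busemannAt f o w x + busemannAt f o (-w) x) ∧
      ∀ i ∈ I, busemannAt f o (e i) x' ≤ 0 ∧ busemannAt f o (-e i) x' ≤ 0 := by
  classical
  induction I using Finset.induction_on with
  | empty => exact ⟨x, fun _ _ => le_rfl, by simp⟩
  | insert i I hi ih =>
    obtain ⟨x₁, h1, h2⟩ := ih
    have key : ∀ t : ℝ, busemannAt f o (e i) x₁ - t ≤ 0 → busemannAt f o (-e i) x₁ + t ≤ 0 →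
        ∃ x', (∀ w : E, ‖w‖ = 1 → busemannAt f o w x' + busemannAt f o (-w) x' ≤
          busemannAt f o w x + busemannAt f o (-w) x) ∧
        ∀ j ∈ insert i I, busemannAt f o (e j) x' ≤ 0 ∧ busemannAt f o (-e j) x' ≤ 0 := by
      intro t ht1 ht2
      have hneg : ∀ j, ‖-e j‖ = 1 := fun j => by rw [norm_neg, he.1 j]
      refine ⟨coneMap f x₁ (t • e i), fun w hw =>
        (hX.busemannAt_add_coneMap_le hf o x₁ _ hw).trans (h1 w hw), fun j hj => ?_⟩
      have k1 := hX.busemannAt_coneMap_le hf o x₁ (t • e i) (he.1 j)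
      have k2 := hX.busemannAt_coneMap_le hf o x₁ (t • e i) (hneg j)
      rw [inner_neg_right] at k2
      rw [inner_smul_left] at k1 k2
      simp only [conj_trivial] at k1 k2
      rcases Finset.mem_insert.1 hj with rfl | hj
      · rw [real_inner_self_eq_norm_sq, he.1] at k1 k2
        constructor <;> linarith
      · have hij : i ≠ j := fun h => hi (h ▸ hj)
        rw [he.2 hij] at k1 k2
        have := h2 j hj
        constructor <;> linarith
    have hsum := (h1 (e i) (he.1 i)).trans (hx i)
    by_cases hp : 0 ≤ busemannAt f o (e i) x₁
    · exact key (busemannAt f o (e i) x₁) (by linarith) (by linarith)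
    · by_cases hq : 0 ≤ busemannAt f o (-e i) x₁
      · exact key (-busemannAt f o (-e i) x₁) (by linarith) (by linarith)
      · exact key 0 (by linarith) (by linarith)

/-- A point minimising a weighted sum of the Busemann functions of the points `± u k`, over the
set where the Busemann functions of the frame `± e i` are nonpositive: from there, these functions
are affine along all the rays towards the sphere. -/
lemma IsHadamardSpace.exists_busemannAt_affine (hX : IsHadamardSpace X) (hf : IsTitsSphere f)
    {ι : Type*} [Fintype ι] {e : ι → E} (he : Orthonormal ℝ e) (o : X)
    (hbd : Bornology.IsBounded
      {y | ∀ i, busemannAt f o (e i) y ≤ 0 ∧ busemannAt f o (-e i) y ≤ 0})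
    {u : ℕ → E} (hu : ∀ k, ‖u k‖ = 1) :
    ∃ x, ∀ k v, busemannAt f o (u k) (coneMap f x v) =
      busemannAt f o (u k) x - inner ℝ v (u k) := by
  set K := {y | ∀ i, busemannAt f o (e i) y ≤ 0 ∧ busemannAt f o (-e i) y ≤ 0} with hK
  have hcont := hX.continuous_busemannAt f o
  have hclosed : IsClosed K := by
    simp only [hK, Set.ofPred_forall, Set.ofPred_and]
    exact isClosed_iInter fun i => (isClosed_le (hcont _) continuous_const).inter
      (isClosed_le (hcont _) continuous_const)
  have hcomp : IsCompact K := Metric.isCompact_of_isClosed_isBounded hclosed hbd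
  have hoK : o ∈ K := fun i => by simp [hX.busemannAt_self]
  obtain ⟨D, hD⟩ := hbd.subset_closedBall o
  set P : ℕ → X → ℝ := fun k y => busemannAt f o (u k) y + busemannAt f o (-u k) y with hP
  set Ψ : X → ℝ := fun y => ∑' k, (1 / 2 : ℝ) ^ k * P k y with hΨ
  have hsum : Summable fun k : ℕ => (1 / 2 : ℝ) ^ k * (2 * D) := summable_geometric_two.mul_right _
  have hbound : ∀ k, ∀ y ∈ K, ‖(1 / 2 : ℝ) ^ k * P k y‖ ≤ (1 / 2 : ℝ) ^ k * (2 * D) := by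
    intro k y hy
    rw [norm_mul, Real.norm_of_nonneg (by positivity)]
    refine mul_le_mul_of_nonneg_left ?_ (by positivity)
    have h1 := hX.abs_busemannAt_le f o (u k) y
    have h2 := hX.abs_busemannAt_le f o (-u k) y
    have h3 : dist o y ≤ D := by rw [dist_comm]; exact hD hy
    rw [Real.norm_eq_abs]
    exact (abs_add_le _ _).trans (by linarith)
  have hsumP : ∀ y ∈ K, Summable fun k : ℕ => (1 / 2 : ℝ) ^ k * P k y := fun y hy =>
    Summable.of_norm_bounded hsum fun k => hbound k y hy
  have hΨc : ContinuousOn Ψ K := continuousOn_tsum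
    (fun k => (continuous_const.mul ((hcont _).add (hcont _))).continuousOn) hsum hbound
  obtain ⟨x, hxK, hmin⟩ := hcomp.exists_isMinOn ⟨o, hoK⟩ hΨc
  refine ⟨x, fun k v => ?_⟩
  have hle : ∀ w : E, ‖w‖ = 1 → _ := fun w hw => hX.busemannAt_add_coneMap_le hf o x v hw
  obtain ⟨x', h1, h2⟩ := hX.exists_busemannAt_nonpos hf he o (coneMap f x v)
    (fun i => (hle _ (he.1 i)).trans (by linarith [(hxK i).1, (hxK i).2])) Finset.univ
  have hx'K : x' ∈ K := fun i => h2 i (Finset.mem_univ i)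
  have hP' : ∀ j, P j x' ≤ P j x := fun j => (h1 _ (hu j)).trans (hle _ (hu j))
  have heq : P k x ≤ P k x' := by
    by_contra! hlt
    have : Ψ x' < Ψ x := Summable.tsum_lt_tsum (i := k)
      (fun j => mul_le_mul_of_nonneg_left (hP' j) (by positivity))
      (mul_lt_mul_of_pos_left hlt (by positivity)) (hsumP x' hx'K) (hsumP x hxK)
    exact absurd (hmin hx'K) (not_le.2 this)
  have h3 := heq.trans (h1 _ (hu k))
  have h4 := hX.busemannAt_coneMap_le hf o x v (hu k)
  have h5 := hX.busemannAt_coneMap_le hf o x v (w := -u k) (by rw [norm_neg, hu])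
  rw [inner_neg_right] at h5
  simp only [hP] at h3
  linarith

/-- If the Busemann functions of a dense set of points of the sphere are affine along the rays
from `x`, then the cone with apex `x` is isometrically embedded. -/
lemma IsHadamardSpace.isometry_coneMap (hX : IsHadamardSpace X) (hf : IsTitsSphere f) (o x : X)
    {u : ℕ → E} (hdense : ∀ v : E, ∀ ε > 0, ∃ k, ‖v‖ - ε ≤ inner ℝ v (u k))
    (haff : ∀ k v, busemannAt f o (u k) (coneMap f x v) =
      busemannAt f o (u k) x - inner ℝ v (u k)) :
    Isometry (coneMap f x) := by
  refine Isometry.of_dist_eq fun v w => le_antisymm ?_ ?_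
  · rw [dist_eq_norm]; exact hX.dist_coneMap_le hf x v w
  · rw [dist_comm, dist_eq_norm]
    refine le_of_forall_pos_le_add fun ε hε => ?_
    obtain ⟨k, hk⟩ := hdense (w - v) ε hε
    have h1 := (hX.isRayTo_rayTo o (f (u k))).isRay.busemann_sub_le (coneMap f x v) (coneMap f x w)
    have h2 := haff k v
    have h3 := haff k w
    rw [inner_sub_left] at hk
    simp only [busemannAt] at h2 h3
    linarith

/-- A dense sequence of unit vectors, with density expressed through the fact that norms are
suprema of inner products with its members. -/
lemma exists_seq_dense_sphere [TopologicalSpace.SeparableSpace E] :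
    ∃ u : ℕ → E, (∀ k, ‖u k‖ = 1) ∧ ∀ v : E, ∀ ε > 0, ∃ k, ‖v‖ - ε ≤ inner ℝ v (u k) := by
  have : SecondCountableTopology E := UniformSpace.secondCountable_of_separable E
  obtain ⟨u₀, hu₀⟩ := exists_norm_eq E zero_le_one
  have : Nonempty (Metric.sphere (0 : E) 1) := ⟨⟨u₀, by simpa using hu₀⟩⟩
  refine ⟨fun k => (TopologicalSpace.denseSeq (Metric.sphere (0 : E) 1) k : E), fun k => by simp,
    fun v ε hε => ?_⟩
  obtain ⟨w, hw, hv⟩ := exists_unit_smul v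
  obtain ⟨k, hk⟩ := (TopologicalSpace.denseRange_denseSeq (Metric.sphere (0 : E) 1)).exists_dist_lt
    ⟨w, by simpa using hw⟩ (ε := ε / (‖v‖ + 1)) (by positivity)
  refine ⟨k, ?_⟩
  set z : E := (TopologicalSpace.denseSeq (Metric.sphere (0 : E) 1) k : E) with hz
  have hk' : ‖w - z‖ < ε / (‖v‖ + 1) := by rw [← dist_eq_norm]; exact hk
  have e1 : inner ℝ v w = ‖v‖ := by
    conv_lhs => rw [hv, inner_smul_left, real_inner_self_eq_norm_sq, hw]
    simp
  have e2 : inner ℝ v (w - z) ≤ ‖v‖ * ‖w - z‖ := real_inner_le_norm _ _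
  rw [inner_sub_right, e1] at e2
  have e3 : ‖v‖ * ‖w - z‖ ≤ ε := by
    rw [lt_div_iff₀ (by positivity)] at hk'
    nlinarith [norm_nonneg (w - z)]
  linarith

end

/-- An isometric ray in a Euclidean space is a straight line. -/
lemma exists_eq_add_smul_of_isometry {E : Type*} [NormedAddCommGroup E] [InnerProductSpace ℝ E]
    {c : ℝ≥0 → E} (hc : Isometry c) : ∃ u : E, ‖u‖ = 1 ∧ ∀ t : ℝ≥0, c t = c 0 + (t : ℝ) • u := by
  have hd : ∀ s t : ℝ≥0, ‖c s - c t‖ = |(s : ℝ) - t| := fun s t => by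
    rw [← dist_eq_norm, hc.dist_eq, NNReal.dist_eq]
  refine ⟨c 1 - c 0, by rw [hd]; simp, fun t => ?_⟩
  have h1 : ‖c t - c 0‖ ^ 2 = (t : ℝ) ^ 2 := by rw [hd, sq_abs]; simp
  have h2 : ‖c 1 - c 0‖ ^ 2 = 1 := by rw [hd, sq_abs]; simp
  have h3 : ‖c t - c 1‖ ^ 2 = ((t : ℝ) - 1) ^ 2 := by rw [hd, sq_abs]; simp
  have h4 := norm_sub_sq_real (c t - c 0) (c 1 - c 0)
  rw [sub_sub_sub_cancel_right, h1, h2, h3] at h4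
  have h5 := norm_sub_sq_real (c t - c 0) ((t : ℝ) • (c 1 - c 0))
  rw [inner_smul_right, norm_smul, mul_pow, Real.norm_eq_abs, sq_abs, h1, h2] at h5
  have h6 : ‖c t - c 0 - (t : ℝ) • (c 1 - c 0)‖ ^ 2 = 0 := by
    rw [h5]; linear_combination -(t : ℝ) * h4
  have h7 := norm_eq_zero.1 (pow_eq_zero_iff (two_ne_zero) |>.1 h6)
  rw [sub_eq_zero] at h7
  rw [← h7, add_sub_cancel]

/-- An isometrically embedded cone is a flat with the expected ideal boundary. -/
lemma IsHadamardSpace.isFlat_range_coneMap [ProperSpace X] (hX : IsHadamardSpace X) {n : ℕ}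
    {f : EuclideanSpace ℝ (Fin n) → IdealBoundary X} {x : X} (hi : Isometry (coneMap f x)) :
    IsFlat (Set.range (coneMap f x)) ∧
      idealBoundaryOf (Set.range (coneMap f x)) = f '' Metric.sphere 0 1 := by
  refine ⟨⟨?_, n, coneMap f x, hi, rfl⟩, ?_⟩
  · rintro _ ⟨v, rfl⟩ _ ⟨w, rfl⟩ γ hγ a ha
    set L := dist (coneMap f x v) (coneMap f x w) with hL
    have hLn : ‖w - v‖ = L := by rw [hL, hi.dist_eq, dist_comm, dist_eq_norm]
    have hL0 : 0 ≤ L := dist_nonneg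
    rcases hL0.eq_or_lt with h0 | hpos
    · obtain rfl : a = 0 := le_antisymm (h0 ▸ ha.2) ha.1
      exact ⟨v, hγ.1.symm⟩
    refine ⟨v + (a / L) • (w - v), ?_⟩
    refine hX.geod_unique (r := fun b => coneMap f x (v + (b / L) • (w - v))) (L := L) ?_
      hγ.isGeod ?_ ?_ ha
    · intro b _ c _
      have : v + (b / L) • (w - v) - (v + (c / L) • (w - v)) = ((b - c) / L) • (w - v) := by
        rw [sub_div]; module
      rw [hi.dist_eq, dist_eq_norm, this, norm_smul, hLn, Real.norm_eq_abs, abs_div,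
        abs_of_pos hpos]
      field_simp
    · simp [hγ.1]
    · simp only [div_self hpos.ne', one_smul, add_sub_cancel]
      exact hγ.2.1.symm
  · ext ξ
    constructor
    · rintro ⟨ρ, hρ, rfl⟩
      choose c hc using hρ
      have hciso : Isometry c := Isometry.of_dist_eq fun s t => by
        rw [← hi.dist_eq, hc, hc, ρ.2.dist_eq]
      obtain ⟨u, hu, hcu⟩ := exists_eq_add_smul_of_isometry hciso
      refine ⟨u, by simpa using hu, ?_⟩
      have hr := hX.isRayTo_rayTo x (f u)
      have hρ' := hr.of_asymptotic ρ.isRayTo.isRay ⟨‖c 0‖, fun t ht => ?_⟩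
      · obtain ⟨σ, hσ, hσ'⟩ := hρ'.exists_endpoint
        rw [← hσ]
        congr 1
        refine Subtype.ext (funext fun t => ?_)
        rw [hσ']; simp
      · have e : dist (coneMap f x (c t.toNNReal)) (coneMap f x (t • u)) = ‖c 0‖ := by
          rw [hi.dist_eq, hcu, Real.coe_toNNReal t ht, dist_eq_norm, add_sub_cancel_right]
        rw [hc, hX.coneMap_smul f x hu ht] at e
        exact e.le
    · rintro ⟨u, hu, rfl⟩
      rw [mem_sphere_zero_iff_norm] at hu
      obtain ⟨ρ, hρ, hr⟩ := (hX.isRayTo_rayTo x (f u)).exists_endpoint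
      exact ⟨ρ, fun t => ⟨(t : ℝ) • u, (hX.coneMap_smul f x hu t.2).trans (hr t).symm⟩, hρ⟩

/-! ### The case of an unbounded sublevel set: an ideal point orthogonal to the sphere -/

section

variable {E : Type*} [NormedAddCommGroup E] [ProperSpace X] {f : E → IdealBoundary X}

/-- A limit of geodesics from `o` to points of an unbounded sublevel set stays in it, because
Busemann functions are convex. -/
lemma IsHadamardSpace.exists_ray_busemannAt_nonpos (hX : IsHadamardSpace X)
    {ι : Type*} {e : ι → E} (o : X)
    (hbd : ¬ Bornology.IsBounded
      {y | ∀ i, busemannAt f o (e i) y ≤ 0 ∧ busemannAt f o (-e i) y ≤ 0}) :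
    ∃ q : ℝ → X, IsRay q ∧ q 0 = o ∧ ∀ t, 0 ≤ t → ∀ i,
      busemannAt f o (e i) (q t) ≤ 0 ∧ busemannAt f o (-e i) (q t) ≤ 0 := by
  have hfar : ∀ n : ℕ, ∃ y, (∀ i, busemannAt f o (e i) y ≤ 0 ∧ busemannAt f o (-e i) y ≤ 0) ∧
      (n : ℝ) ≤ dist o y := by
    intro n
    by_contra! hcon
    refine hbd ((Metric.isBounded_closedBall (x := o) (r := n)).subset fun y hy => ?_)
    rw [Metric.mem_closedBall, dist_comm]
    exact (hcon y hy).le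
  choose y hy hn using hfar
  choose γ hγ h0 h1 using fun n => hX.exists_geod o (y n)
  have hL : Tendsto (fun n => dist o (y n)) atTop atTop :=
    tendsto_atTop_mono hn tendsto_natCast_atTop_atTop
  have hF : ((hyperfilter ℕ : Ultrafilter ℕ) : Filter ℕ) ≤ atTop := Nat.hyperfilter_le_atTop
  obtain ⟨q, hq, hq0, hlim⟩ := exists_limit_ray (hyperfilter ℕ) hγ h0 (hL.mono_left hF)
  have key : ∀ u : E, (∀ n, busemannAt f o u (y n) ≤ 0) → ∀ t, 0 ≤ t →
      busemannAt f o u (q t) ≤ 0 := by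
    intro u hu t ht
    refine le_of_tendsto (((hX.continuous_busemannAt f o u).tendsto _).comp (hlim t ht)) (hF ?_)
    filter_upwards [hL.eventually_ge_atTop t, hL.eventually_gt_atTop 0] with n k1 k2
    have := hX.busemann_convex (hX.isRayTo_rayTo o (f u)).isRay (hγ n) ⟨ht, k1⟩
    rw [h0, h1] at this
    have e0 := hX.busemannAt_self f o u
    have e1 := hu n
    simp only [busemannAt] at e0 e1
    rw [e0, mul_zero, zero_add] at this
    refine nonpos_of_mul_nonpos_right (this.trans ?_) k2
    exact mul_nonpos_of_nonneg_of_nonpos ht e1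
  exact ⟨q, hq, hq0, fun t ht i => ⟨key _ (fun n => (hy n i).1) t ht,
    key _ (fun n => (hy n i).2) t ht⟩⟩

variable [InnerProductSpace ℝ E]

/-- The vectors `v` such that the Busemann function of `q` grows sublinearly along the ray in
direction `v` of the cone with apex `o`. -/
def sublinearDirections (f : E → IdealBoundary X) (o : X) (q : ℝ → X) : Set E :=
  {v | ∀ ε > 0, ∀ᶠ t : ℝ in atTop, busemann q (coneMap f o (t • v)) ≤ ε * t}

lemma IsHadamardSpace.smul_mem_sublinearDirections (hX : IsHadamardSpace X) {o : X} {q : ℝ → X}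
    (hq : IsRay q) (hq0 : q 0 = o) {v : E} (hv : v ∈ sublinearDirections f o q) {c : ℝ}
    (hc : 0 ≤ c) : c • v ∈ sublinearDirections f o q := by
  intro ε hε
  rcases hc.eq_or_lt with rfl | hc
  · filter_upwards [eventually_ge_atTop (0 : ℝ)] with t ht
    rw [zero_smul, smul_zero, hX.coneMap_zero, ← hq0, hq.busemann_zero]
    positivity
  · filter_upwards [(tendsto_id.atTop_mul_const hc).eventually (hv (ε / c) (by positivity))]
      with t ht
    rw [smul_smul]
    refine ht.trans (le_of_eq ?_)
    simp only [id]
    field_simp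

/-- Busemann functions are convex, and the point of the cone over the midpoint of two vectors is
asymptotically the midpoint in `X`. -/
lemma IsHadamardSpace.add_mem_sublinearDirections [Nontrivial E] (hX : IsHadamardSpace X)
    (hf : IsTitsSphere f) {o : X} {q : ℝ → X} (hq : IsRay q) (hq0 : q 0 = o) {v w : E}
    (hv : v ∈ sublinearDirections f o q) (hw : w ∈ sublinearDirections f o q) :
    v + w ∈ sublinearDirections f o q := by
  have hm : (1 / 2 : ℝ) • (v + w) ∈ sublinearDirections f o q := by
    intro ε hε
    filter_upwards [hv (ε / 2) (by positivity), hw (ε / 2) (by positivity),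
      hX.eventually_le_dist_coneMap hf o v w (ε := ε ^ 2) (by positivity),
      eventually_gt_atTop (0 : ℝ)] with t h1 h2 h3 ht
    set A := coneMap f o (t • v) with hA
    set B := coneMap f o (t • w) with hB
    set M := coneMap f o (t • (1 / 2 : ℝ) • (v + w)) with hM
    obtain ⟨γ, hγ, h0, hL⟩ := hX.exists_geod A B
    set L := dist A B with hLd
    have hL0 : 0 ≤ L := dist_nonneg
    have hhalf : L / 2 ∈ Set.Icc 0 L := ⟨by positivity, by linarith⟩
    have hMA : dist M A ≤ t / 2 * ‖v - w‖ := by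
      refine (hX.dist_coneMap_le hf o _ _).trans (le_of_eq ?_)
      have : t • (1 / 2 : ℝ) • (v + w) - t • v = -((t / 2) • (v - w)) := by module
      rw [this, norm_neg, norm_smul, Real.norm_of_nonneg (by positivity)]
    have hMB : dist M B ≤ t / 2 * ‖v - w‖ := by
      refine (hX.dist_coneMap_le hf o _ _).trans (le_of_eq ?_)
      have : t • (1 / 2 : ℝ) • (v + w) - t • w = (t / 2) • (v - w) := by module
      rw [this, norm_smul, Real.norm_of_nonneg (by positivity)]
    rcases hL0.eq_or_lt with hz | hpos
    · have hAB : A = B := dist_eq_zero.1 hz.symm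
      have h4 : dist M A ≤ ε / 2 * t := by
        refine le_of_sq_le_sq ?_ (by positivity)
        have : dist M A ^ 2 ≤ (t / 2 * ‖v - w‖) ^ 2 := by gcongr
        rw [← hz] at h3
        nlinarith
      have := hq.busemann_sub_le M A
      linarith
    have hst := hX.stewart hγ hhalf M
    have hbc := hX.busemann_convex hq hγ hhalf
    rw [h0, hL] at hst hbc
    set N := γ (L / 2) with hN
    have h5 : dist M N ^ 2 ≤ dist M A ^ 2 / 2 + dist M B ^ 2 / 2 - L ^ 2 / 4 := by
      refine le_of_mul_le_mul_left (hst.trans (le_of_eq ?_)) hpos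
      ring
    have h6 : busemann q N ≤ busemann q A / 2 + busemann q B / 2 := by
      refine le_of_mul_le_mul_left (hbc.trans (le_of_eq ?_)) hpos
      ring
    have h7 : dist M N ≤ ε / 2 * t := by
      refine le_of_sq_le_sq ?_ (by positivity)
      have k1 : dist M A ^ 2 ≤ (t / 2 * ‖v - w‖) ^ 2 := by gcongr
      have k2 : dist M B ^ 2 ≤ (t / 2 * ‖v - w‖) ^ 2 := by gcongr
      nlinarith
    have h8 := hq.busemann_sub_le M N
    linarith
  have := hX.smul_mem_sublinearDirections hq hq0 hm (c := 2) (by norm_num)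
  rwa [smul_smul, show (2 : ℝ) * (1 / 2) = 1 by norm_num, one_smul] at this

/-- If the Busemann functions of `± e i` for an orthonormal basis `e` are nonpositive along a ray
from `o`, then so are the Busemann functions of all points of the sphere. -/
lemma IsHadamardSpace.busemannAt_nonpos_of_basis [Nontrivial E] (hX : IsHadamardSpace X)
    (hf : IsTitsSphere f) {ι : Type*} [Fintype ι] (e : OrthonormalBasis ι ℝ E) {o : X}
    {q : ℝ → X} (hq : IsRay q)
    (hq0 : q 0 = o) (hqe : ∀ t, 0 ≤ t → ∀ i,
      busemannAt f o (e i) (q t) ≤ 0 ∧ busemannAt f o (-e i) (q t) ≤ 0)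
    {u : E} (hu : ‖u‖ = 1) {t : ℝ} (ht : 0 ≤ t) : busemannAt f o u (q t) ≤ 0 := by
  obtain ⟨η, hη⟩ : ∃ η, IsRayTo q o η := ⟨_, hq0 ▸ hq.isRayTo⟩
  have hmem : ∀ w : E, ‖w‖ = 1 → (∀ t, 0 ≤ t → busemannAt f o w (q t) ≤ 0) →
      w ∈ sublinearDirections f o q := by
    intro w hw hwq
    have hr := hX.isRayTo_rayTo o (f w)
    have hc : 0 ≤ titsCos (f w) η := by
      rw [hX.titsCos_comm hr hη]
      refine le_of_forall_pos_le_add fun ε hε => ?_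
      obtain ⟨s, h1, h2⟩ := ((hX.eventually_le_busemann hη hr hε).and
        (eventually_gt_atTop 0)).exists
      have h3 := h1.trans (hwq s h2.le)
      by_contra! hneg
      nlinarith [mul_pos h2 (neg_pos.2 hneg)]
    intro ε hε
    filter_upwards [eventually_ge_atTop (0 : ℝ)] with s hs
    rw [hX.coneMap_smul f o hw hs]
    have := hX.busemann_le_titsCos hr hη hs
    nlinarith [mul_nonneg hs hc, mul_nonneg hε.le hs]
  have hall : ∀ w : E, w ∈ sublinearDirections f o q := by
    intro w
    rw [← e.sum_repr w]
    refine Finset.sum_induction _ (· ∈ sublinearDirections f o q)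
      (fun a b ha hb => hX.add_mem_sublinearDirections hf hq hq0 ha hb) ?_ fun i _ => ?_
    · intro ε hε
      filter_upwards [eventually_ge_atTop (0 : ℝ)] with s hs
      rw [smul_zero, hX.coneMap_zero, ← hq0, hq.busemann_zero]
      positivity
    · have hei : ‖e i‖ = 1 := e.orthonormal.1 i
      rcases le_total 0 (e.repr w i) with h | h
      · exact hX.smul_mem_sublinearDirections hq hq0
          (hmem (e i) hei fun t ht => (hqe t ht i).1) h
      · have := hX.smul_mem_sublinearDirections hq hq0
          (hmem (-e i) (by rwa [norm_neg]) fun t ht => (hqe t ht i).2) (neg_nonneg.2 h)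
        rwa [smul_neg, neg_smul, neg_neg] at this
  have hr := hX.isRayTo_rayTo o (f u)
  have hc : 0 ≤ titsCos η (f u) := by
    rw [hX.titsCos_comm hη hr]
    refine le_of_forall_pos_le_add fun ε hε => ?_
    obtain ⟨s, ⟨h1, h2⟩, h3⟩ := (((hX.eventually_le_busemann hr hη (half_pos hε)).and
      (hall u (ε / 2) (half_pos hε))).and (eventually_gt_atTop 0)).exists
    rw [hX.coneMap_smul f o hu h3.le] at h2
    have h4 : s * 0 ≤ s * (titsCos (f u) η + ε) := by linarith
    exact le_of_mul_le_mul_left h4 h3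
  have := hX.busemann_le_titsCos hη hr ht
  refine this.trans ?_
  nlinarith [mul_nonneg ht hc]

end

/-! ### The hemisphere spanned by a sphere and an orthogonal ideal point -/

section

variable {E : Type*} [NormedAddCommGroup E] [InnerProductSpace ℝ E]
  [ProperSpace X] {f : E → IdealBoundary X}

/-- The points of the cones over the sphere with apices on the ray `q`, scaled by `T`. As `T` tends
to infinity these sweep out, asymptotically, the Euclidean half-space of the pairs `(a, v)` with
`0 ≤ a`. -/
noncomputable def halfSpaceMap (f : E → IdealBoundary X) (q : ℝ → X) (T a : ℝ) (v : E) : X :=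
  coneMap f (q (a * T)) (T • v)

/-- `IsHadamardSpace.dist_sq_le` for the rays of a cone, with Busemann functions normalised at a
point `o` other than the apex. -/
lemma IsHadamardSpace.dist_sq_coneMap_le (hX : IsHadamardSpace X) (o z p : X) (u : E)
    (hu : ‖u‖ = 1) {s : ℝ} (hs : 0 ≤ s) :
    dist z (coneMap f p (s • u)) ^ 2 ≤ dist z p ^ 2 + s ^ 2 +
      2 * s * (busemannAt f o u z - busemannAt f o u p) := by
  have h := hX.isRayTo_rayTo p (f u)
  have k := hX.isRayTo_rayTo o (f u)
  have := hX.dist_sq_le h.isRay z hs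
  rw [hX.busemann_eq h.isRay k.isRay (h.asymptotic k), h.zero] at this
  rwa [hX.coneMap_smul f p hu hs]

variable {o : X} {q : ℝ → X}

/-- Along `q` the Busemann functions of the sphere, which are nonpositive, decrease only
sublinearly: otherwise the sum for a pair of antipodes would be too small. -/
lemma IsHadamardSpace.eventually_le_busemannAt_ray (hX : IsHadamardSpace X) (hf : IsTitsSphere f)
    (hq : IsRay q) (hq0 : q 0 = o)
    (hqf : ∀ u : E, ‖u‖ = 1 → ∀ t, 0 ≤ t → busemannAt f o u (q t) ≤ 0) {u : E} (hu : ‖u‖ = 1)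
    {a ε : ℝ} (ha : 0 ≤ a) (hε : 0 < ε) :
    ∀ᶠ T : ℝ in atTop, -ε * T ≤ busemannAt f o u (q (a * T)) := by
  obtain ⟨C, hC⟩ := hX.exists_le_busemannAt_add hf o hu (ε := ε / (2 * (a + 1))) (by positivity)
  filter_upwards [eventually_ge_atTop (0 : ℝ), eventually_ge_atTop (C / (ε / 2))] with T hT hT2
  have haT : 0 ≤ a * T := mul_nonneg ha hT
  have h1 := hC (q (a * T))
  have h2 := hqf (-u) (by rwa [norm_neg]) _ haT
  rw [← hq0, hq.dist_zero haT, hq0] at h1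
  rw [div_le_iff₀ (by positivity)] at hT2
  have h3 : ε / (2 * (a + 1)) * (a * T) ≤ ε / 2 * T := by
    have : ε / (2 * (a + 1)) * (a * T) = ε / 2 * T * (a / (a + 1)) := by field_simp
    rw [this]
    refine mul_le_of_le_one_right (by positivity) ?_
    rw [div_le_one (by positivity)]
    linarith
  linarith

variable [Nontrivial E]

/-- The asymptotic upper bound for distances, by applying `IsHadamardSpace.dist_sq_le` twice. -/
lemma IsHadamardSpace.eventually_dist_halfSpaceMap_le (hX : IsHadamardSpace X)
    (hf : IsTitsSphere f) (hq : IsRay q) (hq0 : q 0 = o)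
    (hqf : ∀ u : E, ‖u‖ = 1 → ∀ t, 0 ≤ t → busemannAt f o u (q t) ≤ 0)
    {a a' ε : ℝ} (ha : 0 ≤ a) (ha' : 0 ≤ a') (v v' : E) (hε : 0 < ε) :
    ∀ᶠ T : ℝ in atTop, dist (halfSpaceMap f q T a v) (halfSpaceMap f q T a' v') ^ 2 ≤
      T ^ 2 * ((a - a') ^ 2 + ‖v - v'‖ ^ 2 + ε) := by
  obtain ⟨u, hu, hv⟩ := exists_unit_smul v
  obtain ⟨u', hu', hv'⟩ := exists_unit_smul v'
  set δ := ε / (2 * (‖v‖ + ‖v'‖ + 1)) with hδ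
  have hδ0 : 0 < δ := by positivity
  filter_upwards [hX.eventually_le_busemannAt_ray hf hq hq0 hqf hu ha hδ0,
    hX.eventually_le_busemannAt_ray hf hq hq0 hqf hu' ha' hδ0,
    eventually_ge_atTop (0 : ℝ)] with T h1 h2 hT
  have hTv : T • v = (T * ‖v‖) • u := by rw [mul_smul, ← hv]
  have hTv' : T • v' = (T * ‖v'‖) • u' := by rw [mul_smul, ← hv']
  have k1 := hX.dist_sq_coneMap_le (f := f) o (q (a' * T)) (q (a * T)) u hu
    (mul_nonneg hT (norm_nonneg v))
  have k2 := hX.dist_sq_coneMap_le (f := f) o (halfSpaceMap f q T a v) (q (a' * T)) u' hu'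
    (mul_nonneg hT (norm_nonneg v'))
  have k3 := hX.busemannAt_coneMap_le hf o (q (a * T)) (T • v) hu'
  have k4 := hqf u' hu' (a * T) (mul_nonneg ha hT)
  have k5 := hqf u hu (a' * T) (mul_nonneg ha' hT)
  rw [← hTv] at k1
  rw [← hTv'] at k2
  have k6 : dist (q (a' * T)) (q (a * T)) ^ 2 = T ^ 2 * (a - a') ^ 2 := by
    rw [hq _ (mul_nonneg ha' hT) _ (mul_nonneg ha hT), sq_abs]; ring
  rw [k6] at k1
  have e1 : inner ℝ (T • v) u' = T * inner ℝ v u' := by rw [inner_smul_left]; simp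
  have e2 : inner ℝ v v' = ‖v'‖ * inner ℝ v u' := by
    conv_lhs => rw [hv', inner_smul_right]
  rw [e1] at k3
  change dist (halfSpaceMap f q T a v) (halfSpaceMap f q T a' v') ^ 2 ≤ _ at k2
  change busemannAt f o u' (halfSpaceMap f q T a v) ≤ _ at k3
  change dist (q (a' * T)) (halfSpaceMap f q T a v) ^ 2 ≤ _ at k1
  rw [dist_comm (q (a' * T))] at k1
  have n1 : 2 * (T * ‖v‖) * (busemannAt f o u (q (a' * T)) - busemannAt f o u (q (a * T))) ≤
      2 * (T * ‖v‖) * (δ * T) :=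
    mul_le_mul_of_nonneg_left (by linarith) (by positivity)
  have n2 : 2 * (T * ‖v'‖) * (busemannAt f o u' (halfSpaceMap f q T a v) -
      busemannAt f o u' (q (a' * T))) ≤ 2 * (T * ‖v'‖) * (δ * T - T * inner ℝ v u') :=
    mul_le_mul_of_nonneg_left (by linarith) (by positivity)
  have n3 : T ^ 2 * (δ * (2 * (‖v‖ + ‖v'‖))) ≤ T ^ 2 * ε := by
    refine mul_le_mul_of_nonneg_left ?_ (by positivity)
    rw [hδ, div_mul_eq_mul_div, div_le_iff₀ (by positivity)]
    nlinarith [norm_nonneg v, norm_nonneg v']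
  rw [norm_sub_sq_real, e2]
  linarith

/-- The asymptotic lower bound for the distance to `o`: the apex `q (a T)` is asymptotically the
midpoint of the points over `v` and `-v`, so the parallelogram inequality bounds the distance of
one of these points from below in terms of the upper bound for the other. -/
lemma IsHadamardSpace.eventually_le_dist_halfSpaceMap (hX : IsHadamardSpace X)
    (hf : IsTitsSphere f) (hq : IsRay q) (hq0 : q 0 = o)
    (hqf : ∀ u : E, ‖u‖ = 1 → ∀ t, 0 ≤ t → busemannAt f o u (q t) ≤ 0)
    {a ε : ℝ} (ha : 0 ≤ a) (v : E) (hε : 0 < ε) :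
    ∀ᶠ T : ℝ in atTop,
      T ^ 2 * (a ^ 2 + ‖v‖ ^ 2 - ε) ≤ dist o (halfSpaceMap f q T a v) ^ 2 := by
  obtain ⟨u, hu, hv⟩ := exists_unit_smul v
  obtain ⟨δ, hδε, hδ0⟩ : ∃ δ : ℝ, 4 * a * √(δ * ‖v‖) + 2 * δ * ‖v‖ + δ < ε ∧ 0 < δ := by
    have hc : Continuous fun δ : ℝ => 4 * a * √(δ * ‖v‖) + 2 * δ * ‖v‖ + δ := by fun_prop
    have h0 := (hc.tendsto 0).eventually_lt_const (show _ < ε by simpa using hε)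
    exact ((h0.filter_mono nhdsWithin_le_nhds).and (self_mem_nhdsWithin (s := Set.Ioi 0))).exists
  obtain ⟨C, hC⟩ := hX.exists_le_busemannAt_add hf o hu (ε := δ / (2 * (a + ‖v‖ + 1)))
    (by positivity)
  filter_upwards [hX.eventually_dist_halfSpaceMap_le hf hq hq0 hqf ha le_rfl (-v) 0 hδ0,
    eventually_gt_atTop (0 : ℝ), eventually_ge_atTop (C / (δ / 2))] with T h1 hT hT2
  rw [div_le_iff₀ (by positivity)] at hT2
  have haT : 0 ≤ a * T := mul_nonneg ha hT.le
  set p := q (a * T) with hp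
  set s := T * ‖v‖ with hs
  have hs0 : 0 ≤ s := by positivity
  set y := halfSpaceMap f q T a v with hy
  set z := halfSpaceMap f q T a (-v) with hz
  have hTv : T • v = s • u := by rw [hs, mul_smul, ← hv]
  have hyp : y = coneMap f p (s • u) := by rw [hy, halfSpaceMap, hTv]
  have hzp : z = coneMap f p (-(s • u)) := by rw [hz, halfSpaceMap, smul_neg, hTv]
  have ho : halfSpaceMap f q T 0 (0 : E) = o := by
    rw [halfSpaceMap, zero_mul, smul_zero, hX.coneMap_zero, hq0]
  rw [ho, sub_zero, sub_zero, norm_neg, dist_comm] at h1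
  have hsu : ‖s • u‖ = s := by rw [norm_smul, hu, Real.norm_of_nonneg hs0, mul_one]
  have hpy : dist p y = s := by rw [hyp, hX.dist_coneMap_zero, hsu]
  have hpz : dist p z = s := by rw [hzp, hX.dist_coneMap_zero, norm_neg, hsu]
  have hop : dist o p = a * T := by rw [← hq0]; exact hq.dist_zero haT
  have hin : inner ℝ (s • u) u = s := by
    rw [inner_smul_left, real_inner_self_eq_norm_sq, hu]; simp
  set ℓ := dist y z with hℓ
  have hℓ1 : ℓ ≤ 2 * s := by
    have := dist_triangle_left y z p
    linarith
  have hℓ2 : 2 * s - δ * T ≤ ℓ := by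
    have k1 := hX.busemannAt_coneMap_le hf o p (s • u) hu
    have k2 := hX.busemannAt_coneMap_le hf o p (-(s • u)) (w := -u) (by rwa [norm_neg])
    rw [inner_neg_neg] at k2
    rw [← hyp] at k1
    rw [← hzp] at k2
    rw [hin] at k1 k2
    have k3 := hqf u hu _ haT
    have k4 := hqf (-u) (by rwa [norm_neg]) _ haT
    rw [← hp] at k3 k4
    have k5 := hC z
    have k6 := (hX.isRayTo_rayTo o (f u)).isRay.busemann_sub_le z y
    change busemannAt f o u z - busemannAt f o u y ≤ _ at k6
    rw [dist_comm, ← hℓ] at k6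
    have k7 : dist o z ≤ T * (a + ‖v‖) := by
      have := dist_triangle o p z
      rw [hop, hpz, hs] at this
      linarith
    have k8 : δ / (2 * (a + ‖v‖ + 1)) * dist o z ≤ δ / 2 * T := by
      refine (mul_le_mul_of_nonneg_left k7 (by positivity)).trans ?_
      have : δ / (2 * (a + ‖v‖ + 1)) * (T * (a + ‖v‖)) =
        δ / 2 * T * ((a + ‖v‖) / (a + ‖v‖ + 1)) := by field_simp
      rw [this]
      refine mul_le_of_le_one_right (by positivity) ?_
      rw [div_le_one (by positivity)]
      linarith
    linarith
  obtain ⟨γ, hγ, h0, hL⟩ := hX.exists_geod y z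
  rw [← hℓ] at hγ hL
  have hℓ0 : 0 ≤ ℓ := dist_nonneg
  have hhalf : ℓ / 2 ∈ Set.Icc 0 ℓ := ⟨by positivity, by linarith⟩
  set m := γ (ℓ / 2) with hm
  -- the parallelogram inequality
  have hmed : ∀ x : X, dist x m ^ 2 ≤ dist x y ^ 2 / 2 + dist x z ^ 2 / 2 - ℓ ^ 2 / 4 := by
    intro x
    rcases hℓ0.eq_or_lt with hzero | hpos
    · have hyz : y = z := dist_eq_zero.1 hzero.symm
      rw [hm, ← hzero, zero_div, h0, ← hyz]
      linarith
    · have hst := hX.stewart hγ hhalf x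
      rw [h0, hL] at hst
      refine le_of_mul_le_mul_left (hst.trans (le_of_eq ?_)) hpos
      ring
  have m1 := hmed p
  have m2 := hmed o
  rw [hpy, hpz] at m1
  -- the apex is close to the midpoint `m` of `y` and `z`
  have hgap : s ^ 2 - ℓ ^ 2 / 4 ≤ δ * ‖v‖ * T ^ 2 := by
    have : (s - ℓ / 2) * (s + ℓ / 2) ≤ (δ * T / 2) * (2 * s) :=
      mul_le_mul (by linarith) (by linarith) (by linarith) (by positivity)
    rw [hs] at this ⊢
    linarith
  have hpm : dist p m ≤ √(δ * ‖v‖) * T := by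
    refine le_of_sq_le_sq ?_ (by positivity)
    rw [mul_pow, Real.sq_sqrt (by positivity)]
    linarith
  have hom : a ^ 2 * T ^ 2 - 2 * (a * T) * (√(δ * ‖v‖) * T) ≤ dist o m ^ 2 := by
    have := dist_triangle o m p
    rw [hop, dist_comm m p] at this
    have h2 : a * T - √(δ * ‖v‖) * T ≤ dist o m := by linarith
    rcases le_total 0 (a * T - √(δ * ‖v‖) * T) with h | h
    · have : (a * T - √(δ * ‖v‖) * T) ^ 2 ≤ dist o m ^ 2 := by gcongr
      nlinarith [sq_nonneg (√(δ * ‖v‖) * T)]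
    · have : 0 ≤ √(δ * ‖v‖) * T := by positivity
      nlinarith [sq_nonneg (dist o m)]
  have hfin : T ^ 2 * (4 * a * √(δ * ‖v‖) + 2 * δ * ‖v‖ + δ) ≤ T ^ 2 * ε := by gcongr
  have hs2 : s ^ 2 = T ^ 2 * ‖v‖ ^ 2 := by rw [hs]; ring
  rw [hs2] at hgap
  linarith

/-- Limits, along an ultrafilter, of the geodesics from `o` to the points of the asymptotic
half-space. -/
lemma IsHadamardSpace.exists_hemisphere_rays (hX : IsHadamardSpace X)
    (hf : IsTitsSphere f) (hq : IsRay q) (hq0 : q 0 = o)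
    (hqf : ∀ u : E, ‖u‖ = 1 → ∀ t, 0 ≤ t → busemannAt f o u (q t) ≤ 0) :
    ∃ ζ : ℝ → E → ℝ → X,
      (∀ a v, 0 ≤ a → a ^ 2 + ‖v‖ ^ 2 = 1 → IsRay (ζ a v) ∧ ζ a v 0 = o) ∧
      (∀ v, ‖v‖ = 1 → ∀ t, 0 ≤ t → ζ 0 v t = rayTo o (f v) t) ∧
      ∀ a v a' v', 0 ≤ a → 0 ≤ a' → a ^ 2 + ‖v‖ ^ 2 = 1 → a' ^ 2 + ‖v'‖ ^ 2 = 1 →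
        ∀ t s, 0 ≤ t → 0 ≤ s → dist (ζ a v t) (ζ a' v' s) ^ 2 ≤
          t ^ 2 + s ^ 2 - 2 * t * s * (a * a' + inner ℝ v v') := by
  set F : Ultrafilter ℝ := Ultrafilter.of atTop with hFdef
  have hF : (F : Filter ℝ) ≤ atTop := Ultrafilter.of_le _
  set y : ℝ → ℝ → E → X := fun T a v => halfSpaceMap f q T a v with hy
  choose γ hγ h0 h1 using fun T a v => hX.exists_geod o (y T a v)
  have hlow : ∀ {a : ℝ} {v : E} {ε : ℝ}, 0 ≤ a → a ^ 2 + ‖v‖ ^ 2 = 1 → 0 < ε →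
      ∀ᶠ T in atTop, T ^ 2 * (1 - ε) ≤ dist o (y T a v) ^ 2 := by
    intro a v ε ha hav hε
    have := hX.eventually_le_dist_halfSpaceMap hf hq hq0 hqf ha v hε
    rwa [hav] at this
  have hupp : ∀ {a : ℝ} {v : E} {ε : ℝ}, 0 ≤ a → a ^ 2 + ‖v‖ ^ 2 = 1 → 0 < ε →
      ∀ᶠ T in atTop, dist o (y T a v) ^ 2 ≤ T ^ 2 * (1 + ε) := by
    intro a v ε ha hav hε
    filter_upwards [hX.eventually_dist_halfSpaceMap_le hf hq hq0 hqf ha le_rfl v 0 hε] with T hT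
    have ho : halfSpaceMap f q T 0 (0 : E) = o := by
      rw [halfSpaceMap, zero_mul, smul_zero, hX.coneMap_zero, hq0]
    rw [ho, sub_zero, sub_zero, hav, dist_comm] at hT
    exact hT
  have hLat : ∀ {a : ℝ} {v : E}, 0 ≤ a → a ^ 2 + ‖v‖ ^ 2 = 1 →
      Tendsto (fun T => dist o (y T a v)) atTop atTop := by
    intro a v ha hav
    refine tendsto_atTop_mono' atTop ?_ (tendsto_id.atTop_mul_const (one_half_pos (α := ℝ)))
    filter_upwards [hlow ha hav (ε := 1 / 2) (by norm_num), eventually_ge_atTop (0 : ℝ)] with T hT h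
    refine le_of_sq_le_sq ?_ dist_nonneg
    simp only [id]
    nlinarith [sq_nonneg T]
  have hray : ∀ a v, ∃ r : ℝ → X, 0 ≤ a → a ^ 2 + ‖v‖ ^ 2 = 1 → IsRay r ∧ r 0 = o ∧
      ∀ t, 0 ≤ t → Tendsto (fun T => γ T a v t) F (𝓝 (r t)) := by
    intro a v
    by_cases h : 0 ≤ a ∧ a ^ 2 + ‖v‖ ^ 2 = 1
    · obtain ⟨r, hr⟩ := exists_limit_ray F (fun T => hγ T a v) (fun T => h0 T a v)
        ((hLat h.1 h.2).mono_left hF)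
      exact ⟨r, fun _ _ => hr⟩
    · exact ⟨q, fun ha hav => absurd ⟨ha, hav⟩ h⟩
  choose ζ hζ using hray
  refine ⟨ζ, fun a v ha hav => ⟨(hζ a v ha hav).1, (hζ a v ha hav).2.1⟩, ?_, ?_⟩
  · intro v hv t ht
    have hav : (0 : ℝ) ^ 2 + ‖v‖ ^ 2 = 1 := by rw [hv]; norm_num
    have hr := hX.isRayTo_rayTo o (f v)
    refine tendsto_nhds_unique ((hζ 0 v le_rfl hav).2.2 t ht) (tendsto_const_nhds.congr' (hF ?_))
    filter_upwards [eventually_ge_atTop t] with T hT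
    have hT0 := ht.trans hT
    have hyT : y T 0 v = rayTo o (f v) T := by
      simp only [hy, halfSpaceMap]
      rw [zero_mul, hq0, hX.coneMap_smul f o hv hT0]
    have hd : dist o (y T 0 v) = T := by
      have := hr.isRay.dist_zero hT0
      rw [hyT]; rwa [hr.zero] at this
    have e0 := h0 T 0 v
    have e1 := h1 T 0 v
    have eg := hγ T 0 v
    rw [hd] at e1 eg
    exact hX.geod_unique (hr.isRay.isGeod T) eg (hr.zero.trans e0.symm) (by rw [e1, hyT]) ⟨ht, hT⟩
  · intro a v a' v' ha ha' hav hav' t s ht hs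
    refine le_of_forall_pos_le_add fun ε' hε' => ?_
    obtain ⟨ε, hε, hεb⟩ : ∃ ε > 0, 5 * t * s * ε ≤ ε' := by
      refine ⟨ε' / (5 * t * s + 1), by positivity, ?_⟩
      rw [mul_div_assoc', div_le_iff₀ (by positivity)]
      nlinarith
    refine le_of_tendsto ((((hζ a v ha hav).2.2 t ht).dist
      ((hζ a' v' ha' hav').2.2 s hs)).pow 2) (hF ?_)
    filter_upwards [hlow ha hav hε, hupp ha hav hε, hlow ha' hav' hε, hupp ha' hav' hε,
      hX.eventually_dist_halfSpaceMap_le hf hq hq0 hqf ha ha' v v' hε, eventually_gt_atTop (0 : ℝ),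
      (hLat ha hav).eventually_ge_atTop t, (hLat ha' hav').eventually_ge_atTop s]
      with T k1 k2 k3 k4 k5 hT k6 k7
    have hm := hX.comparison_mono (hγ T a v) (hγ T a' v')
      ((h0 T a v).trans (h0 T a' v').symm) ⟨ht, k6⟩ ⟨hs, k7⟩
    rw [h1, h1] at hm
    set L := dist o (y T a v) with hL
    set M := dist o (y T a' v') with hM
    have hL0 : 0 ≤ L := dist_nonneg
    have hM0 : 0 ≤ M := dist_nonneg
    set d := dist (γ T a v t) (γ T a' v' s) with hd
    have hd0 : 0 ≤ d := dist_nonneg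
    have g1 : dist o (γ T a v t) = t := by
      rw [← h0 T a v]; exact (hγ T a v).dist_zero ⟨ht, k6⟩
    have g2 : dist o (γ T a' v' s) = s := by
      rw [← h0 T a' v']; exact (hγ T a' v').dist_zero ⟨hs, k7⟩
    have hd1 : d ^ 2 ≤ (t + s) ^ 2 := by
      have := dist_triangle_left (γ T a v t) (γ T a' v' s) o
      rw [g1, g2] at this
      gcongr
    have hd2 : (t - s) ^ 2 ≤ d ^ 2 := by
      have := abs_dist_sub_le (γ T a v t) (γ T a' v' s) o
      rw [dist_comm _ o, dist_comm _ o, g1, g2] at this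
      rw [← sq_abs]; gcongr
    set Q := t ^ 2 + s ^ 2 - d ^ 2 with hQ
    have hQ1 : |Q| ≤ 2 * t * s := abs_le.2 ⟨by linarith, by linarith⟩
    set I := a * a' + inner ℝ v v' with hI
    have hD : dist (y T a v) (y T a' v') ^ 2 ≤ T ^ 2 * (2 - 2 * I + ε) := by
      refine k5.trans (le_of_eq ?_)
      rw [norm_sub_sq_real]
      linear_combination T ^ 2 * (hav + hav')
    -- `L / T` and `M / T` tend to `1`
    have hLM : |L * M - T ^ 2| ≤ T ^ 2 * ε := by
      have hLM0 : 0 ≤ L * M := mul_nonneg hL0 hM0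
      refine abs_le.2 ⟨?_, ?_⟩
      · by_cases hε1 : ε ≤ 1
        · have : (T ^ 2 * (1 - ε)) ^ 2 ≤ (L * M) ^ 2 := by
            rw [mul_pow L M, sq (T ^ 2 * (1 - ε))]
            exact mul_le_mul k1 k3 (mul_nonneg (sq_nonneg T) (by linarith)) (sq_nonneg L)
          linarith [le_of_sq_le_sq this hLM0]
        · nlinarith [sq_nonneg T]
      · have : L * M ≤ T ^ 2 * (1 + ε) := by nlinarith [sq_nonneg (L - M)]
        linarith
    have h2 : t * s * (T ^ 2 * (2 * I - 3 * ε)) ≤ L * M * Q := by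
      refine le_trans (mul_le_mul_of_nonneg_left ?_ (mul_nonneg ht hs)) hm
      linarith
    have h3 : (L * M - T ^ 2) * Q ≤ (T ^ 2 * ε) * (2 * t * s) := by
      refine (le_abs_self _).trans ?_
      rw [abs_mul]
      exact mul_le_mul hLM hQ1 (abs_nonneg _) (by positivity)
    have h4 : T ^ 2 * (t * s * (2 * I - 5 * ε)) ≤ T ^ 2 * Q := by linarith
    have h5 := le_of_mul_le_mul_left h4 (by positivity)
    linarith

/-- The hemisphere spanned by a sphere and an ideal point `q(∞)` along whose ray the Busemann
functions of the points of the sphere are nonpositive. A point of the hemisphere has coordinates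
`(a, v)` with `0 ≤ a` and `a ^ 2 + ‖v‖ ^ 2 = 1`. -/
theorem IsHadamardSpace.exists_hemisphere (hX : IsHadamardSpace X)
    (hf : IsTitsSphere f) (hq : IsRay q) (hq0 : q 0 = o)
    (hqf : ∀ u : E, ‖u‖ = 1 → ∀ t, 0 ≤ t → busemannAt f o u (q t) ≤ 0) :
    ∃ h : ℝ → E → IdealBoundary X, (∀ v, ‖v‖ = 1 → h 0 v = f v) ∧
      ∀ a v a' v', 0 ≤ a → 0 ≤ a' → a ^ 2 + ‖v‖ ^ 2 = 1 → a' ^ 2 + ‖v'‖ ^ 2 = 1 →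
        titsAngle (h a v) (h a' v') = Real.arccos (a * a' + inner ℝ v v') := by
  obtain ⟨ζ, hζ, hζ0, hup⟩ := hX.exists_hemisphere_rays hf hq hq0 hqf
  have hex : ∀ a v, ∃ ξ, 0 ≤ a → a ^ 2 + ‖v‖ ^ 2 = 1 → IsRayTo (ζ a v) o ξ := by
    intro a v
    by_cases h : 0 ≤ a ∧ a ^ 2 + ‖v‖ ^ 2 = 1
    · obtain ⟨h1, h2⟩ := hζ a v h.1 h.2
      exact ⟨_, fun _ _ => h2 ▸ h1.isRayTo⟩
    · exact ⟨hq.toRay.endpoint, fun ha hav => absurd ⟨ha, hav⟩ h⟩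
  choose h hh using hex
  have hbdry : ∀ v, ‖v‖ = 1 → h 0 v = f v := by
    intro v hv
    have k1 := hh 0 v le_rfl (by rw [hv]; norm_num)
    have hr := hX.isRayTo_rayTo o (f v)
    have k2 := hr.of_asymptotic k1.isRay ⟨0, fun t ht => by rw [hζ0 v hv t ht, dist_self]⟩
    obtain ⟨ρ, hρ, hρ'⟩ := k1.exists_endpoint
    obtain ⟨σ, hσ, hσ'⟩ := k2.exists_endpoint
    rw [← hρ, ← hσ]
    congr 1
    exact Subtype.ext (funext fun t => (hρ' t).trans (hσ' t).symm)
  refine ⟨h, hbdry, fun a v a' v' ha ha' hav hav' => ?_⟩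
  have upper : ∀ {a v w}, 0 ≤ a → a ^ 2 + ‖v‖ ^ 2 = 1 → ‖w‖ = 1 → ∀ t, 0 ≤ t →
      busemannAt f o w (ζ a v t) ≤ -t * inner ℝ v w := by
    intro a v w ha hav hw t ht
    refine (hX.isRayTo_rayTo o (f w)).isRay.busemann_le_of_dist_sq_le (A := t ^ 2) fun s hs => ?_
    have := hup a v 0 w ha le_rfl hav (by rw [hw]; norm_num) t s ht hs
    rw [hζ0 w hw s hs, mul_zero, zero_add] at this
    linarith
  have lower : ∀ {a v w}, 0 ≤ a → a ^ 2 + ‖v‖ ^ 2 = 1 → ‖w‖ = 1 → ∀ ε > 0, ∃ C, ∀ t, 0 ≤ t →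
      -t * inner ℝ v w - ε * t - C ≤ busemannAt f o w (ζ a v t) := by
    intro a v w ha hav hw ε hε
    obtain ⟨C, hC⟩ := hX.exists_le_busemannAt_add hf o hw hε
    refine ⟨C, fun t ht => ?_⟩
    have h1 := upper ha hav (w := -w) (by rwa [norm_neg]) t ht
    have h2 := hC (ζ a v t)
    obtain ⟨h3, h4⟩ := hζ a v ha hav
    rw [← h4, h3.dist_zero ht, h4] at h2
    rw [inner_neg_right] at h1
    linarith
  -- the case where one of the points lies on the boundary sphere
  have hzero : ∀ {a' v v'}, 0 ≤ a' → ‖v‖ = 1 → a' ^ 2 + ‖v'‖ ^ 2 = 1 →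
      titsCos (h a' v') (h 0 v) ≤ inner ℝ v' v := by
    intro a' v v' ha' hv hav'
    rw [hbdry v hv]
    have hr := hX.isRayTo_rayTo o (f v)
    refine le_of_forall_pos_le_add fun ε hε => ?_
    obtain ⟨C, hC⟩ := lower ha' hav' hv (ε / 2) (half_pos hε)
    obtain ⟨t, h1, h2⟩ := ((eventually_ge_atTop (C / (ε / 2))).and
      (eventually_gt_atTop (0 : ℝ))).exists
    rw [div_le_iff₀ (by positivity)] at h1
    have h3 := hX.busemann_le_titsCos (hh a' v' ha' hav') hr h2.le
    have h4 := hC t h2.le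
    simp only [busemannAt] at h4
    refine le_of_mul_le_mul_left (a := t) (by linarith) h2
  have k1 := hh a v ha hav
  have k2 := hh a' v' ha' hav'
  rw [hX.titsAngle_eq_arccos_titsCos k1 k2]
  congr 1
  refine le_antisymm ?_ (hX.le_titsCos k1 k2 (hup a v a' v' ha ha' hav hav'))
  rcases ha.eq_or_lt with rfl | hpos
  · have hv : ‖v‖ = 1 := by
      rw [← pow_eq_one_iff_of_nonneg (norm_nonneg v) two_ne_zero]
      linarith
    rw [hX.titsCos_comm k1 k2, zero_mul, zero_add, real_inner_comm]
    exact hzero ha' hv hav'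
  rcases ha'.eq_or_lt with rfl | hpos'
  · have hv' : ‖v'‖ = 1 := by
      rw [← pow_eq_one_iff_of_nonneg (norm_nonneg v') two_ne_zero]
      linarith
    rw [mul_zero, zero_add]
    exact hzero ha hv' hav
  -- the points at times `τ a'` and `τ a` have the same height over the boundary sphere, and their
  -- difference is `τ w₀`
  set w₀ := a' • v - a • v' with hw₀
  obtain ⟨w, hw, hw₀w⟩ := exists_unit_smul w₀
  have hnorm : ‖w₀‖ ^ 2 = a ^ 2 + a' ^ 2 - 2 * a * a' * (a * a' + inner ℝ v v') := by
    rw [hw₀, norm_sub_sq_real, inner_smul_left, inner_smul_right, norm_smul, norm_smul,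
      mul_pow, mul_pow, Real.norm_eq_abs, Real.norm_eq_abs, sq_abs, sq_abs]
    simp only [conj_trivial]
    linear_combination a' ^ 2 * hav + a ^ 2 * hav'
  have hinner : a' * inner ℝ v w - a * inner ℝ v' w = ‖w₀‖ := by
    have : inner ℝ w₀ w = ‖w₀‖ := by
      conv_lhs => rw [hw₀w, inner_smul_left, real_inner_self_eq_norm_sq, hw]
      simp
    rw [← this, hw₀, inner_sub_left, inner_smul_left, inner_smul_left]
    simp
  set c := titsCos (h a v) (h a' v') with hc
  have hdist : ∀ τ, 0 ≤ τ → dist (ζ a v (τ * a')) (ζ a' v' (τ * a)) ^ 2 ≤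
      τ ^ 2 * (a ^ 2 + a' ^ 2 - 2 * a * a' * c) := fun τ hτ => by
    have := hX.dist_sq_le_titsCos k1 k2 (mul_nonneg hτ ha') (mul_nonneg hτ ha)
    linarith
  have hR0 : 0 ≤ a ^ 2 + a' ^ 2 - 2 * a * a' * c := by
    have := (sq_nonneg _).trans (hdist 1 zero_le_one)
    linarith
  have hle : ‖w₀‖ ≤ √(a ^ 2 + a' ^ 2 - 2 * a * a' * c) := by
    refine le_of_forall_pos_le_add fun ε hε => ?_
    obtain ⟨C, hC⟩ := lower ha' hav' hw (ε / (2 * a)) (by positivity)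
    obtain ⟨τ, h1, h2⟩ := ((eventually_ge_atTop (C / (ε / 2))).and
      (eventually_gt_atTop (0 : ℝ))).exists
    rw [div_le_iff₀ (by positivity)] at h1
    have h3 := hC (τ * a) (by positivity)
    have h4 := upper ha hav hw (τ * a') (by positivity)
    have h5 := (hX.isRayTo_rayTo o (f w)).isRay.busemann_sub_le (ζ a' v' (τ * a)) (ζ a v (τ * a'))
    have h6 : dist (ζ a v (τ * a')) (ζ a' v' (τ * a)) ≤
        τ * √(a ^ 2 + a' ^ 2 - 2 * a * a' * c) := by
      refine le_of_sq_le_sq ?_ (by positivity)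
      rw [mul_pow, Real.sq_sqrt hR0]
      exact hdist τ h2.le
    rw [dist_comm] at h5
    have h7 : ε / (2 * a) * (τ * a) = ε / 2 * τ := by field_simp
    rw [h7] at h3
    change busemannAt f o w _ - busemannAt f o w _ ≤ _ at h5
    have h8 : τ * (a' * inner ℝ v w - a * inner ℝ v' w) = τ * ‖w₀‖ := by rw [hinner]
    refine le_of_mul_le_mul_left (a := τ) (by linarith) h2
  have h9 := (Real.le_sqrt (norm_nonneg _) hR0).1 hle
  rw [hnorm] at h9
  refine le_of_mul_le_mul_left (a := 2 * a * a') (by linarith) (by positivity)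

end

/-- A sphere is the boundary of a hemisphere as soon as some ray `q` is orthogonal to it. -/
lemma IsHadamardSpace.boundsUnitHemisphere [ProperSpace X] (hX : IsHadamardSpace X) {d : ℕ}
    {f : EuclideanSpace ℝ (Fin (d + 1)) → IdealBoundary X} (hf : IsTitsSphere f) {o : X}
    {q : ℝ → X} (hq : IsRay q) (hq0 : q 0 = o)
    (hqf : ∀ u, ‖u‖ = 1 → ∀ t, 0 ≤ t → busemannAt f o u (q t) ≤ 0) :
    BoundsUnitHemisphere (f '' Metric.sphere 0 1) := by
  obtain ⟨h, h0, hangle⟩ := hX.exists_hemisphere hf hq hq0 hqf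
  set tl : EuclideanSpace ℝ (Fin (d + 2)) → EuclideanSpace ℝ (Fin (d + 1)) :=
    fun u => WithLp.toLp 2 fun i => u i.succ with htl
  have hinner : ∀ u v, inner ℝ u v = u 0 * v 0 + inner ℝ (tl u) (tl v) := by
    intro u v
    simp only [htl, PiLp.inner_apply, Fin.sum_univ_succ (n := d + 1)]
    simp [mul_comm]
  have hnorm : ∀ u, ‖u‖ = 1 → u 0 ^ 2 + ‖tl u‖ ^ 2 = 1 := by
    intro u hu
    have := hinner u u
    rw [real_inner_self_eq_norm_sq, real_inner_self_eq_norm_sq, hu] at this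
    linarith
  refine ⟨d + 1, fun u => h (u 0) (tl u), ?_, ?_⟩
  · rintro u ⟨hu, hu0⟩ v ⟨hv, hv0⟩
    rw [mem_sphere_zero_iff_norm] at hu hv
    rw [hangle _ _ _ _ hu0 hv0 (hnorm u hu) (hnorm v hv), ← hinner, InnerProductGeometry.angle,
      hu, hv, mul_one, div_one]
  · ext ξ
    constructor
    · rintro ⟨u, ⟨hu, hu0⟩, rfl⟩
      rw [mem_sphere_zero_iff_norm] at hu
      have h1 := hnorm u hu
      rw [hu0, zero_pow two_ne_zero, zero_add,
        pow_eq_one_iff_of_nonneg (norm_nonneg _) two_ne_zero] at h1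
      exact ⟨tl u, by simpa using h1, by simp only [hu0]; exact (h0 _ h1).symm⟩
    · rintro ⟨v, hv, rfl⟩
      rw [mem_sphere_zero_iff_norm] at hv
      set u : EuclideanSpace ℝ (Fin (d + 2)) := WithLp.toLp 2 (Fin.cons 0 fun i => v i) with hu
      have hu0 : u 0 = 0 := rfl
      have htu : tl u = v := rfl
      refine ⟨u, ⟨?_, hu0⟩, ?_⟩
      · rw [mem_sphere_zero_iff_norm, ← pow_eq_one_iff_of_nonneg (norm_nonneg _) two_ne_zero,
          ← real_inner_self_eq_norm_sq, hinner, hu0, htu, real_inner_self_eq_norm_sq, hv]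
        norm_num
      · simp only [hu0, htu]
        exact h0 v hv

end TitsGeometry

theorem mainTheorem11 {X : Type*} [MetricSpace X] [LocallyCompactSpace X]
    (hX : TitsGeometry.IsHadamardSpace X)
    (s : Set (TitsGeometry.IdealBoundary X))
    (hs : TitsGeometry.IsUnitSphere s)
    (hbound : ¬ TitsGeometry.BoundsUnitHemisphere s) :
    ∃ F : Set X, TitsGeometry.IsFlat F ∧ TitsGeometry.idealBoundaryOf F = s := by
  open TitsGeometry in
  have := hX.properSpace
  obtain ⟨d, f, hf, rfl⟩ := hs
  have hsphere : IsTitsSphere f := fun u v hu hv => by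
    rw [titsCos, hf u (by simpa using hu) v (by simpa using hv), InnerProductGeometry.cos_angle,
      hu, hv, mul_one, div_one]
  let e := EuclideanSpace.basisFun (Fin (d + 1)) ℝ
  obtain ⟨ρ, -⟩ : ∃ ρ : Ray X, ρ.endpoint = f (e 0) := Quotient.exists_rep _
  let o : X := ρ.1 0
  by_cases hbd : Bornology.IsBounded
      {y | ∀ i, busemannAt f o (e i) y ≤ 0 ∧ busemannAt f o (-e i) y ≤ 0}
  · obtain ⟨u, hu, hdense⟩ := exists_seq_dense_sphere (E := EuclideanSpace ℝ (Fin (d + 1)))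
    obtain ⟨x, hx⟩ := hX.exists_busemannAt_affine hsphere e.orthonormal o hbd hu
    exact ⟨_, hX.isFlat_range_coneMap (hX.isometry_coneMap hsphere o x hdense hx)⟩
  · obtain ⟨q, hq, hq0, hqe⟩ := hX.exists_ray_busemannAt_nonpos o hbd
    exact absurd (hX.boundsUnitHemisphere hsphere hq hq0 fun u hu t ht =>
      hX.busemannAt_nonpos_of_basis hsphere e hq hq0 hqe hu ht) hbound
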